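/- Let $M$ be a nonempty compact smooth manifold of dimension $n\ge 1$ (possibly with boundary). A Finsler metric on $M$ is a function $L:TM\to[0,\infty)$, positive and smooth outside the zero section, positively homogeneous of degree one, whose unit sphere in every $T_xM$ is quadratically convex (all principal curvatures are positive, for any Euclidean structure on $T_xM$); $L$ need not be reversible. Its Legendre transform $\mathcal L:TM\to T^*M$ sends a unit vector $v\in T_xM$ to the covector $\xi$ such that $\xi(v)=1$ and $\xi\le 1$ on the unit sphere of $T_xM$, and is extended homogeneously; the Hamiltonian of $L$ is $H:=L\circ\mathcal L^{-1}:T^*M\to[0,\infty)$, and $D^*(M,H):=\{p\in T^*M: H(p)\le 1\}$. Let $\alpha=\sum p_i\,dq_i$ be the canonical one-form on $T^*M$, $\omega=d\alpha$, $V(A):=\int_A \omega^n/n!$ the symplectic volume, and let the Holmes--Thompson volume ${\rm vol}(M,L)$ be $V(D^*(M,H))$ divided by the volume of the Euclidean unit ball of dimension $n$. Let $L$ and $L_0$ be Finsler metrics on $M$ with Hamiltonians $H$ and $H_0$, and let $0\le k\le n$. Put $\Omega:=\alpha\wedge(d\alpha)^{n-1}/n!$ and $U:=D^*(M,H_0)$,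 with boundary hypersurface $\partial U=\{H_0=1\}$. For star bodies $A_i=\{F_i\le 1\}$, $1\le i\le n$, in $T^*M$, with radial functions $\rho_{i}=1/F_i$ on $\partial U$, the dual mixed volume is $\widetilde V(A_1,\dots,A_n):=\int_{\partial U}\rho_1\cdots\rho_n\,\Omega$. Let $\widetilde V_k(M;L,L_0)$ be the dual mixed volume of $n-k$ copies of $D^*(M,H)$ and $k$ copies of $D^*(M,H_0)$, and let $$\widetilde{\mathcal E}_k(M,L):=\frac{\widetilde V_k(M;L,L_0)}{V(D^*(M,H_0))}$$ be the normalized dual mixed volume. Then ${\rm vol}(M,L)$ and ${\rm vol}(M,L_0)$ are positive and finite, and $$\widetilde{\mathcal E}_k(M,L)^n\le\frac{{\rm vol}(M,L)^{n-k}}{{\rm vol}(M,L_0)^{n-k}}.$$ -/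

import Mathlib

open Bundle MeasureTheory Set
open scoped Manifold ContDiff ENNReal

noncomputable section

namespace Finsler

/-- Euclidean `n`-space, the model vector space of `n`-dimensional manifolds. -/
abbrev Euc (n : ℕ) : Type := EuclideanSpace ℝ (Fin n)

/-! ### Finsler metrics and the Legendre transform -/

section Metrics

variable {n : ℕ} {B : Type*} [TopologicalSpace B] (I : ModelWithCorners ℝ (Euc n) B)
  (M : Type*) [TopologicalSpace M] [ChartedSpace B M] [IsManifold I ∞ M]

/-- A (not necessarily reversible) Finsler metric on `M`: a nonnegative function on the tangent
bundle that is positive and smooth outside the zero section, positively homogeneous of degree one,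
and whose unit sphere in each tangent space is quadratically convex.

At a point `v` of the unit sphere `S = {L = 1}` of `T_x M`, the tangent space of `S` is the kernel
of `w ↦ dL_v(w)`, and with respect to any Euclidean structure on `T_x M` and the inner unit normal
the second fundamental form of the level set `S` is `D²L_v(w, w) / |∇L(v)|`. So the principal
curvatures are all positive if and only if `D²L_v(w, w) > 0` for all nonzero `w` tangent to `S`;
both derivatives are written below as derivatives along the line `t ↦ v + t w` in `T_x M`. -/
structure FinslerMetric where
  /-- the Lagrangian -/
  toFun : TangentBundle I M → ℝ
  nonneg : ∀ v, 0 ≤ toFun v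
  pos : ∀ v : TangentBundle I M, v.2 ≠ 0 → 0 < toFun v
  smooth : ContMDiffOn I.tangent 𝓘(ℝ, ℝ) ∞ toFun {v : TangentBundle I M | v.2 ≠ 0}
  homogeneous : ∀ (x : M) (v : TangentSpace I x) (t : ℝ), 0 < t →
    toFun ⟨x, t • v⟩ = t * toFun ⟨x, v⟩
  quadratically_convex : ∀ (x : M) (v w : TangentSpace I x), toFun ⟨x, v⟩ = 1 → w ≠ 0 →
    deriv (fun t : ℝ => toFun ⟨x, v + t • w⟩) 0 = 0 →
    0 < iteratedDeriv 2 (fun t : ℝ => toFun ⟨x, v + t • w⟩) 0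

/-- The cotangent bundle `T^*M` (as the set of pairs of a point `x` and a covector at `x`). -/
abbrev CotangentBundle : Type _ :=
  TotalSpace (Euc n →L[ℝ] ℝ) (fun x : M => TangentSpace I x →L[ℝ] ℝ)

variable {I M}

/-- `IsLegendre L x v ξ` says that `ξ ∈ T_x^*M` is the Legendre transform of `v ∈ T_x M`.
For `v` in the unit sphere `S` it says that `ξ v = 1` and `ξ ≤ 1` on `S`, i.e. the hyperplane
`ξ = 1` touches `S` at `v` and `S` lies in the half-space `ξ ≤ 1`; for other `v` this is extended
by homogeneity of degree one. -/
def IsLegendre (L : FinslerMetric I M) (x : M) (v : TangentSpace I x)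
    (ξ : TangentSpace I x →L[ℝ] ℝ) : Prop :=
  ξ v = L.toFun ⟨x, v⟩ ^ 2 ∧ ∀ w : TangentSpace I x, ξ w ≤ L.toFun ⟨x, v⟩ * L.toFun ⟨x, w⟩

/-- The Hamiltonian `H = L ∘ 𝓛⁻¹` of a Finsler metric, with `𝓛` the Legendre transform. -/
def hamiltonian (L : FinslerMetric I M) (p : CotangentBundle I M) : ℝ :=
  L.toFun ⟨p.1, Classical.epsilon fun v : TangentSpace I p.1 => IsLegendre L p.1 v p.2⟩

/-- The value of the Hamiltonian does not depend on the choice in its definition. -/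
theorem hamiltonian_eq_of_isLegendre (L : FinslerMetric I M) {x : M} {v : TangentSpace I x}
    {ξ : TangentSpace I x →L[ℝ] ℝ} (h : IsLegendre L x v ξ) :
    hamiltonian L ⟨x, ξ⟩ = L.toFun ⟨x, v⟩ := by
  have h' : IsLegendre L x (Classical.epsilon fun v => IsLegendre L x v ξ) ξ :=
    Classical.epsilon_spec (p := fun v : TangentSpace I x => IsLegendre L x v ξ) ⟨v, h⟩
  have key : ∀ u u' : TangentSpace I x, IsLegendre L x u ξ → IsLegendre L x u' ξ →
      L.toFun ⟨x, u⟩ ≤ L.toFun ⟨x, u'⟩ := by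
    intro u u' hu hu'
    have h1 := hu'.2 u
    rw [hu.1] at h1
    by_contra hlt
    have h2 := L.nonneg ⟨x, u'⟩
    nlinarith
  exact le_antisymm (key _ _ h' h) (key _ _ h h')

/-- The unit codisc bundle `D^*(M, H) = {H ≤ 1}`. -/
def codisc (H : CotangentBundle I M → ℝ) : Set (CotangentBundle I M) := {p | H p ≤ 1}

end Metrics

/-! ### The canonical forms in canonical coordinates -/

section Forms

variable {n : ℕ}

/-- The space of canonical coordinates `(q, p) = (q_1, …, q_n, p_1, …, p_n)`. -/
abbrev PhaseSpace (n : ℕ) : Type := Euc n × Euc n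

/-- The canonical one-form `α = ∑ p_i dq_i`. -/
def canonicalForm (z : PhaseSpace n) : PhaseSpace n →L[ℝ] ℝ :=
  (innerSL ℝ z.2).comp (ContinuousLinearMap.fst ℝ (Euc n) (Euc n))

/-- The symplectic form `ω = dα`. -/
def symplecticForm (z X Y : PhaseSpace n) : ℝ :=
  fderiv ℝ (canonicalForm (n := n)) z X Y - fderiv ℝ (canonicalForm (n := n)) z Y X

/-- The Liouville volume form `ω^n / n!`, evaluated on `2n` vectors, which are indexed by
`Fin n × Fin 2`. The wedge power is
`ω^n (v) = 2^{-n} ∑_σ sign σ ∏_i ω (v_{σ (i,0)}, v_{σ (i,1)})`. -/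
def liouvilleForm (z : PhaseSpace n) (v : Fin n × Fin 2 → PhaseSpace n) : ℝ :=
  (1 / (n.factorial * 2 ^ n : ℝ)) * ∑ σ : Equiv.Perm (Fin n × Fin 2),
    ((Equiv.Perm.sign σ : ℤ) : ℝ) * ∏ i : Fin n, symplecticForm z (v (σ (i, 0))) (v (σ (i, 1)))

/-- The form `Ω = α ∧ (dα)^{n-1} / n!`, evaluated on `2n - 1` vectors, which are indexed by
`Option (Fin (n - 1) × Fin 2)`. -/
def omegaForm (z : PhaseSpace n) (v : Option (Fin (n - 1) × Fin 2) → PhaseSpace n) : ℝ :=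
  (1 / (n.factorial * 2 ^ (n - 1) : ℝ)) * ∑ σ : Equiv.Perm (Option (Fin (n - 1) × Fin 2)),
    ((Equiv.Perm.sign σ : ℤ) : ℝ) * (canonicalForm z (v (σ none)) *
      ∏ i : Fin (n - 1), symplecticForm z (v (σ (some (i, 0)))) (v (σ (some (i, 1)))))

/-- The coordinate frame `∂/∂q_i`, `∂/∂p_i`. -/
def coordFrame (j : Fin n × Fin 2) : PhaseSpace n :=
  if j.2 = 0 then (EuclideanSpace.single j.1 1, 0) else (0, EuclideanSpace.single j.1 1)

theorem finrank_tangent_sphere (θ : Metric.sphere (0 : Euc n) 1) :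
    Module.finrank ℝ (Submodule.span ℝ {(θ : Euc n)})ᗮ = n - 1 := by
  have hθ : (θ : Euc n) ≠ 0 := ne_zero_of_mem_unit_sphere θ
  have h := (Submodule.span ℝ {(θ : Euc n)}).finrank_add_finrank_orthogonal
  rw [finrank_span_singleton hθ, finrank_euclideanSpace_fin] at h
  omega

/-- An orthonormal basis of the tangent space `θ^⊥` of the Euclidean unit sphere at `θ`. -/
def sphereFrame (θ : Metric.sphere (0 : Euc n) 1) :
    OrthonormalBasis (Fin (n - 1)) ℝ (Submodule.span ℝ {(θ : Euc n)})ᗮ :=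
  (stdOrthonormalBasis ℝ _).reindex (finCongr (finrank_tangent_sphere θ))

/-- The orthonormal frame of `ℝ^n × S^{n-1}` at `(q, θ)` that consists of the vectors `∂/∂q_i` and
of the orthonormal frame of `S^{n-1}` at `θ`, arranged as a family of `2n - 1` vectors. -/
def productFrame [NeZero n] (θ : Metric.sphere (0 : Euc n) 1) :
    Option (Fin (n - 1) × Fin 2) → PhaseSpace n
  | none => (EuclideanSpace.single 0 1, 0)
  | some (i, j) =>
    if j = 0 then (EuclideanSpace.single ⟨i.1 + 1, by omega⟩ 1, 0)
    else (0, ((sphereFrame θ i : (Submodule.span ℝ {(θ : Euc n)})ᗮ) : Euc n))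

end Forms

/-! ### Integration over the cotangent bundle and over hypersurfaces in it -/

section Integration

variable {n : ℕ} {B : Type*} [TopologicalSpace B] (I : ModelWithCorners ℝ (Euc n) B)
  {M : Type*} [TopologicalSpace M] [ChartedSpace B M] [IsManifold I ∞ M]

/-- The covector with canonical coordinates `(q, p)`, with respect to the chart `φ` of `M` around
`x₀`: it is the covector `∑ p_i dq_i` at the point `x = φ⁻¹(q)`. -/
def cotangentCoord (x₀ : M) (z : PhaseSpace n) : CotangentBundle I M :=
  ⟨(extChartAt I x₀).symm z.1,
    ContinuousLinearMap.comp (innerSL ℝ z.2 : Euc n →L[ℝ] ℝ)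
      (mfderiv I 𝓘(ℝ, Euc n) (extChartAt I x₀) ((extChartAt I x₀).symm z.1))⟩

variable (M) in
/-- A smooth partition of unity on `M`, indexed by the points of `M`, subordinate to the chart
domains. As usual, the integrals below do not depend on which one is taken. -/
def chartPartition [T2Space M] [CompactSpace M] : SmoothPartitionOfUnity M I M univ :=
  Classical.choose (SmoothPartitionOfUnity.exists_isSubordinate_chartAt_source I M)

/-- The symplectic volume `V(A) = ∫_A ω^n / n!` of a subset of the cotangent bundle (oriented by
`ω^n`): the sum over a partition of unity of the integrals in canonical coordinates. -/
def symplecticVolume [T2Space M] [CompactSpace M] (A : Set (CotangentBundle I M)) : ℝ≥0∞ :=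
  ∑' x₀ : M, ∫⁻ z in (extChartAt I x₀).target ×ˢ (univ : Set (Euc n)),
    ENNReal.ofReal (chartPartition I M x₀ ((extChartAt I x₀).symm z.1)) *
      A.indicator 1 (cotangentCoord I x₀ z) *
      ENNReal.ofReal |liouvilleForm z coordFrame|

/-- The radial parametrization `(q, θ) ↦ (q, θ / H(q, θ))` of the hypersurface `H = 1` in canonical
coordinates, written for all `θ ≠ 0` (it is constant on rays). -/
def radialParam (H : CotangentBundle I M → ℝ) (x₀ : M) (z : PhaseSpace n) : PhaseSpace n :=
  (z.1, (H (cotangentCoord I x₀ z))⁻¹ • z.2)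

/-- The integral `∫_{∂U} f Ω` of a nonnegative function over the hypersurface `∂U = {H = 1}`
(oriented by `Ω`, that is, as the boundary of `U = {H ≤ 1}`): over each chart of `M`, the form `Ω`
is pulled back by the radial parametrization `Ψ` of `∂U` and integrated over pairs
`(q, θ) ∈ φ(chart) × S^{n-1}`, and the results are summed with a partition of unity. -/
def boundaryIntegral [NeZero n] [T2Space M] [CompactSpace M] (H : CotangentBundle I M → ℝ)
    (f : CotangentBundle I M → ℝ≥0∞) : ℝ≥0∞ :=
  ∑' x₀ : M, ∫⁻ z in (extChartAt I x₀).target ×ˢ (univ : Set (Metric.sphere (0 : Euc n) 1)),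
    ENNReal.ofReal (chartPartition I M x₀ ((extChartAt I x₀).symm z.1)) *
      f (cotangentCoord I x₀ (radialParam I H x₀ (z.1, z.2))) *
      ENNReal.ofReal |omegaForm (radialParam I H x₀ (z.1, z.2)) fun j =>
        fderivWithin ℝ (radialParam I H x₀) ((extChartAt I x₀).target ×ˢ univ) (z.1, z.2)
          (productFrame z.2 j)|
    ∂((volume : Measure (Euc n)).prod (volume : Measure (Euc n)).toSphere)

/-! ### Dual mixed volumes and Holmes–Thompson volume -/

/-- The dual mixed volume of the `n` star bodies `{A i ≤ 1}`, computed with the model body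
`{U ≤ 1}`: the integral `∫_{∂U} ρ_1 ⋯ ρ_n Ω`, where the radial function `ρ_i` of the `i`-th body
is the restriction of `1 / A i` to `∂U`. -/
def dualMixedVolume [NeZero n] [T2Space M] [CompactSpace M] (U : CotangentBundle I M → ℝ)
    (A : Fin n → CotangentBundle I M → ℝ) : ℝ≥0∞ :=
  boundaryIntegral I U fun p => ENNReal.ofReal (∏ i : Fin n, 1 / A i p)

/-- `V_k(A, B) = V(A, …, A, B, …, B)` with `n - k` copies of `A` and `k` copies of `B`. -/
def dualMixedVolumeK [NeZero n] [T2Space M] [CompactSpace M] (k : ℕ)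
    (U A B : CotangentBundle I M → ℝ) : ℝ≥0∞ :=
  dualMixedVolume I U fun i : Fin n => if i.1 < n - k then A else B

variable {I} in
/-- The normalized dual mixed volume of `L` with respect to the model metric `L₀`,
`V_k(D^*(M, H), D^*(M, H₀)) / V(D^*(M, H₀))`. -/
def normalizedDualMixedVolume [NeZero n] [T2Space M] [CompactSpace M] (k : ℕ)
    (L L₀ : FinslerMetric I M) : ℝ≥0∞ :=
  dualMixedVolumeK I k (hamiltonian L₀) (hamiltonian L) (hamiltonian L₀) /
    symplecticVolume I (codisc (hamiltonian L₀))

variable {I} in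
/-- The Holmes–Thompson volume of `(M, L)`: the symplectic volume of the unit codisc bundle divided
by the volume of the Euclidean unit ball. -/
def holmesThompsonVolume [T2Space M] [CompactSpace M] (L : FinslerMetric I M) : ℝ≥0∞ :=
  symplecticVolume I (codisc (hamiltonian L)) / volume (Metric.closedBall (0 : Euc n) 1)

end Integration

end Finsler

end

/-!
In the canonical coordinates `(q, p)` over a chart of `M`, the Liouville form `ω^n / n!` is, up to
sign, the Lebesgue measure `dq dp` (`abs_liouvilleForm_coordFrame`), and the pullback of
`Ω = α ∧ (dα)^{n-1} / n!` to `ℝ^n × S^{n-1}` by the radial parametrization `(q, θ) ↦ (q, ρ θ)` of a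
star hypersurface, `ρ = 1 / H₀`, is `ρ^n / n dq dθ` up to sign (`abs_omegaForm_radial`). The
derivatives of `ρ` do not enter, because they only add multiples of the radial field `R` to the
arguments of `Ω`, and `ι_R Ω = 0`. Integration in polar coordinates then gives, with
`ρ_H(q, θ) = 1 / H(q, θ)` and a partition of unity understood,

* `V(D^*(M, H)) = ∫ ρ_H^n / n dθ dq` (`symplecticVolume_codisc`),
* `V_k(D^*(M, H), D^*(M, H₀)) = ∫ ρ_H^{n-k} ρ_{H₀}^k / n dθ dq` (`dualMixedVolumeK_hamiltonian`),

and Hölder's inequality for these integrals is the dual Minkowski inequality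
`V_k ^ n ≤ V(D^*(M, H))^{n-k} V(D^*(M, H₀))^k` (`dualMixedVolumeK_pow_le`), from which the theorem
follows by dividing. Hölder's inequality is used in the form of the weighted
arithmetic-geometric mean inequality for the densities `ρ_H^n` and `ρ_{H₀}^n`, each divided by its
total integral.

The Hamiltonian enters as the support function of the unit ball of `L`, that is,
`H(q, p) = max_w p(w) / L(q, w)` over the Euclidean unit sphere (`isGreatest_hamiltonianCoord`). It
follows that `H` is continuous, positive and homogeneous; the volumes are finite because `1 / H ≤ L`
on unit vectors and `L` is bounded over compact sets. The pullback of `Ω` involves the derivative of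
`H₀`, which exists (`differentiableWithinAt_hamiltonianCoord`) by the envelope theorem: quadratic
convexity makes the maximum point `w` unique.
-/

namespace Finsler

/-! ### Wedge products of a linear form with powers of a bilinear form -/

section WedgePowers

variable {V κ : Type*} [AddCommGroup V] [Module ℝ V] [Fintype κ] [DecidableEq κ]

/-- The multilinear map `v ↦ α (v none) * ∏ i, β (v (i, 0)) (v (i, 1))`. -/
def pairingProduct (κ : Type*) [Fintype κ] [DecidableEq κ] (α : V →ₗ[ℝ] ℝ)
    (β : V →ₗ[ℝ] V →ₗ[ℝ] ℝ) :
    MultilinearMap ℝ (fun _ : Option (κ × Fin 2) => V) ℝ :=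
  MultilinearMap.mk' (fun v => α (v none) * ∏ i, β (v (some (i, 0))) (v (some (i, 1))))
    (by
      rintro v (_ | ⟨i, b⟩) x y
      · simp [add_mul]
      · have key : (∏ k, β (Function.update v (some (i, b)) x (some (k, 0)))
              (Function.update v (some (i, b)) x (some (k, 1)))) +
            (∏ k, β (Function.update v (some (i, b)) y (some (k, 0)))
              (Function.update v (some (i, b)) y (some (k, 1)))) =
            ∏ k, β (Function.update v (some (i, b)) (x + y) (some (k, 0)))
              (Function.update v (some (i, b)) (x + y) (some (k, 1))) := by
          refine Finset.prod_add_prod_eq (Finset.mem_univ i) ?_ ?_ ?_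
          · fin_cases b <;> simp
          · intro j _ hj; simp [hj]
          · intro j _ hj; simp [hj]
        simp only [← key, mul_add]
        simp)
    (by
      rintro v (_ | ⟨i, b⟩) c x
      · simp [mul_assoc]
      · have key : (∏ k, β (Function.update v (some (i, b)) (c • x) (some (k, 0)))
              (Function.update v (some (i, b)) (c • x) (some (k, 1)))) =
            c * ∏ k, β (Function.update v (some (i, b)) x (some (k, 0)))
              (Function.update v (some (i, b)) x (some (k, 1))) := by
          rw [← Finset.mul_prod_erase _ _ (Finset.mem_univ i),
            ← Finset.mul_prod_erase Finset.univ
              (fun k => β (Function.update v (some (i, b)) x (some (k, 0)))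
                (Function.update v (some (i, b)) x (some (k, 1)))) (Finset.mem_univ i),
            ← mul_assoc]
          congr 1
          · fin_cases b <;> simp
          · refine Finset.prod_congr rfl fun j hj => ?_
            have hj := Finset.ne_of_mem_erase hj
            simp [hj]
        simp only [key, smul_eq_mul]
        simp only [ne_eq, reduceCtorEq, not_false_eq_true, Function.update_of_ne]
        ring)

/-- The alternating form `∑_σ sign σ α (v_{σ none}) ∏ i, β (v_{σ (i, 0)}, v_{σ (i, 1)})`, a multiple
of `α ∧ β^m` with `m = card κ`. -/
def wedgeSum (κ : Type*) [Fintype κ] [DecidableEq κ] (α : V →ₗ[ℝ] ℝ)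
    (β : V →ₗ[ℝ] V →ₗ[ℝ] ℝ) : V [⋀^Option (κ × Fin 2)]→ₗ[ℝ] ℝ :=
  MultilinearMap.alternatization (pairingProduct κ α β)

theorem wedgeSum_apply (α : V →ₗ[ℝ] ℝ) (β : V →ₗ[ℝ] V →ₗ[ℝ] ℝ) (v : Option (κ × Fin 2) → V) :
    wedgeSum κ α β v = ∑ σ : Equiv.Perm (Option (κ × Fin 2)), ((Equiv.Perm.sign σ : ℤ) : ℝ) *
      (α (v (σ none)) * ∏ i, β (v (σ (some (i, 0)))) (v (σ (some (i, 1))))) := by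
  simp only [wedgeSum, MultilinearMap.alternatization_apply]
  refine Finset.sum_congr rfl fun σ _ => ?_
  simp [pairingProduct, Units.smul_def]

/-- If `ι_R β` is a multiple of `α` and `α R = 0`, then `ι_R (α ∧ β^m) = 0`. In the sum over
permutations, the terms of `σ` and of `σ ∘ (none, s)` cancel, where `s` is the slot which is paired
by `β` with the slot of `R`. -/
theorem wedgeSum_eq_zero_of_apply_eq (α : V →ₗ[ℝ] ℝ) (β : V →ₗ[ℝ] V →ₗ[ℝ] ℝ) (R : V) (c : ℝ)
    (hα : α R = 0) (hβ : ∀ u, β R u = c * α u) (hβ' : ∀ u, β u R = -(c * α u))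
    (v : Option (κ × Fin 2) → V) (j : Option (κ × Fin 2)) (hj : v j = R) :
    wedgeSum κ α β v = 0 := by
  rw [wedgeSum_apply]
  -- the slot paired by `β` with a given one
  let flip : Option (κ × Fin 2) → Option (κ × Fin 2) := Option.map fun s => (s.1, 1 - s.2)
  have hfn : ∀ s, s ≠ none → flip s ≠ none := by
    rintro (_ | s) h <;> simp_all [flip]
  let τ : Equiv.Perm (Option (κ × Fin 2)) → Equiv.Perm (Option (κ × Fin 2)) := fun σ =>
    Equiv.swap none (flip (σ.symm j))
  have hτ : ∀ σ : Equiv.Perm (Option (κ × Fin 2)), σ.symm j ≠ none →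
      (σ * τ σ).symm j = σ.symm j := by
    intro σ h
    have hne : σ.symm j ≠ flip (σ.symm j) := by
      rcases h' : σ.symm j with _ | ⟨i, b⟩
      · exact absurd h' h
      · fin_cases b <;> simp [flip]
    rw [Equiv.symm_apply_eq]
    simp only [τ, Equiv.Perm.mul_apply]
    rw [Equiv.swap_apply_of_ne_of_ne h hne]
    simp
  have hzero : ∀ σ : Equiv.Perm (Option (κ × Fin 2)), σ.symm j = none → α (v (σ none)) = 0 := by
    intro σ h
    rw [← h, Equiv.apply_symm_apply, hj, hα]
  refine Finset.sum_involution
    (fun σ _ => if σ.symm j = none then σ else σ * τ σ) ?_ ?_ (fun _ _ => Finset.mem_univ _) ?_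
  · intro σ _
    by_cases h : σ.symm j = none
    · simp [h, hzero σ h]
    · obtain ⟨⟨i, b⟩, hs⟩ := Option.ne_none_iff_exists'.1 h
      have hσ : σ (some (i, b)) = j := by rw [← hs, Equiv.apply_symm_apply]
      have hflip : τ σ = Equiv.swap none (some (i, 1 - b)) := by simp [τ, hs, flip]
      have hsign : ((Equiv.Perm.sign (σ * τ σ) : ℤ) : ℝ) = -((Equiv.Perm.sign σ : ℤ) : ℝ) := by
        rw [hflip, map_mul, Equiv.Perm.sign_swap (by simp)]
        simp
      simp only [h, if_false]
      rw [hsign, ← Finset.mul_prod_erase _ _ (Finset.mem_univ i),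
        ← Finset.mul_prod_erase Finset.univ
          (fun k => β (v ((σ * τ σ) (some (k, 0)))) (v ((σ * τ σ) (some (k, 1)))))
          (Finset.mem_univ i)]
      have herase : ∏ k ∈ Finset.univ.erase i,
            β (v ((σ * τ σ) (some (k, 0)))) (v ((σ * τ σ) (some (k, 1)))) =
          ∏ k ∈ Finset.univ.erase i, β (v (σ (some (k, 0)))) (v (σ (some (k, 1)))) := by
        refine Finset.prod_congr rfl fun k hk => ?_
        have hk := Finset.ne_of_mem_erase hk
        rw [hflip, Equiv.Perm.mul_apply, Equiv.Perm.mul_apply,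
          Equiv.swap_apply_of_ne_of_ne (by simp) (by simp [hk]),
          Equiv.swap_apply_of_ne_of_ne (by simp) (by simp [hk])]
      rw [herase, hflip]
      fin_cases b
      · simp only [Fin.zero_eta, Fin.isValue, sub_zero] at hσ ⊢
        rw [Equiv.Perm.mul_apply, Equiv.Perm.mul_apply, Equiv.Perm.mul_apply,
          Equiv.swap_apply_left, Equiv.swap_apply_right,
          Equiv.swap_apply_of_ne_of_ne (by simp) (by simp), hσ, hj, hβ, hβ]
        ring
      · simp only [Fin.mk_one, Fin.isValue, sub_self] at hσ ⊢
        rw [Equiv.Perm.mul_apply, Equiv.Perm.mul_apply, Equiv.Perm.mul_apply,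
          Equiv.swap_apply_left, Equiv.swap_apply_right,
          Equiv.swap_apply_of_ne_of_ne (by simp) (by simp), hσ, hj, hβ', hβ']
        ring
  · intro σ _ hne h
    by_cases h' : σ.symm j = none
    · exact hne (by simp [hzero σ h'])
    · simp only [h', if_false] at h
      have h1 : τ σ = 1 := by simpa using h
      exact (hfn _ h').symm (Equiv.swap_eq_one_iff.1 h1)
  · intro σ _
    by_cases h : σ.symm j = none
    · simp [h]
    · have h2 := hτ σ h
      simp only [h, if_false, h2]
      have : τ (σ * τ σ) = τ σ := by simp only [τ] at h2 ⊢; rw [h2]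
      rw [this, mul_assoc, Equiv.swap_mul_self, mul_one]

/-- `α ∧ β^m` does not change when multiples of `R` are added to its arguments. -/
theorem wedgeSum_add_smul (α : V →ₗ[ℝ] ℝ) (β : V →ₗ[ℝ] V →ₗ[ℝ] ℝ) (R : V) (c : ℝ)
    (hα : α R = 0) (hβ : ∀ u, β R u = c * α u) (hβ' : ∀ u, β u R = -(c * α u))
    (v : Option (κ × Fin 2) → V) (a : Option (κ × Fin 2) → ℝ) :
    wedgeSum κ α β (fun j => v j + a j • R) = wedgeSum κ α β v := by
  have h := AlternatingMap.map_add_univ (wedgeSum κ α β) v (fun j => a j • R)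
  have h' : wedgeSum κ α β (fun j => v j + a j • R) =
      wedgeSum κ α β (v + fun j => a j • R) := rfl
  rw [h', h, Finset.sum_eq_single Finset.univ]
  · simp
  · intro s _ hs
    obtain ⟨j, hj⟩ : ∃ j, j ∉ s := by
      by_contra hcon
      push Not at hcon
      exact hs (Finset.eq_univ_iff_forall.2 hcon)
    have hupd : s.piecewise v (fun j => a j • R) =
        Function.update (s.piecewise v (fun j => a j • R)) j (a j • R) := by
      rw [eq_comm, Function.update_eq_self_iff]
      simp [hj]
    rw [hupd, AlternatingMap.map_update_smul, wedgeSum_eq_zero_of_apply_eq α β R c hα hβ hβ' _ j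
      (by simp), smul_zero]
  · simp

/-- The value of the sum over all permutations which computes `β^m` on a symplectic frame. -/
theorem sum_perm_prod_symplectic (J : κ × Fin 2 → κ × Fin 2 → ℝ)
    (h00 : ∀ a b, J (a, 0) (b, 0) = 0) (h11 : ∀ a b, J (a, 1) (b, 1) = 0)
    (h01 : ∀ a b, J (a, 0) (b, 1) = if a = b then -1 else 0)
    (h10 : ∀ a b, J (a, 1) (b, 0) = if a = b then 1 else 0) :
    ∑ σ : Equiv.Perm (κ × Fin 2), ((Equiv.Perm.sign σ : ℤ) : ℝ) *
      ∏ i, J (σ (i, 0)) (σ (i, 1)) =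
    (-1) ^ Fintype.card κ * (Fintype.card κ).factorial * 2 ^ Fintype.card κ := by
  -- the permutations which respect the pairs contribute `(-1) ^ card κ` each, the others `0`
  let F : Equiv.Perm κ × (κ → Equiv.Perm (Fin 2)) → Equiv.Perm (κ × Fin 2) := fun p =>
    Equiv.prodCongrLeft (fun _ => p.1) * Equiv.prodCongrRight p.2
  have hF : ∀ p i b, F p (i, b) = (p.1 i, p.2 i b) := fun p i b => rfl
  have hinj : Function.Injective F := by
    rintro ⟨ϖ, τ⟩ ⟨ϖ', τ'⟩ h
    have h1 : ∀ i b, (ϖ i, τ i b) = (ϖ' i, τ' i b) := fun i b => by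
      rw [← hF (ϖ, τ) i b, h, hF]
    ext1
    · ext i; exact congrArg Prod.fst (h1 i 0)
    · funext i; ext b; exact congrArg (fun x => (x.2 : ℕ)) (h1 i b)
  have hterm : ∀ p, ((Equiv.Perm.sign (F p) : ℤ) : ℝ) * ∏ i, J (F p (i, 0)) (F p (i, 1)) =
      (-1) ^ Fintype.card κ := by
    rintro ⟨ϖ, τ⟩
    have hs : Equiv.Perm.sign (F (ϖ, τ)) = ∏ i, Equiv.Perm.sign (τ i) := by
      simp only [F, map_mul, Equiv.Perm.sign_prodCongrRight, Equiv.Perm.sign_prodCongrLeft]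
      simp
    rw [hs]
    push_cast
    rw [← Finset.prod_mul_distrib, ← Finset.card_univ, ← Finset.prod_const]
    refine Finset.prod_congr rfl fun i _ => ?_
    rw [hF, hF]
    have : τ i = 1 ∨ τ i = Equiv.swap 0 1 := by
      generalize τ i = t
      revert t; decide
    rcases this with h | h <;> simp [h, h01, h10]
  have hout : ∀ σ ∈ Finset.univ, σ ∉ Finset.univ.image F →
      ((Equiv.Perm.sign σ : ℤ) : ℝ) * ∏ i, J (σ (i, 0)) (σ (i, 1)) = 0 := by
    intro σ _ hσ
    by_contra hne
    apply hσ
    have hJ : ∀ i, J (σ (i, 0)) (σ (i, 1)) ≠ 0 := fun i h0 =>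
      hne (by rw [Finset.prod_eq_zero (Finset.mem_univ i) h0, mul_zero])
    have hpair : ∀ i, (σ (i, 1)).1 = (σ (i, 0)).1 ∧ (σ (i, 1)).2 = 1 - (σ (i, 0)).2 := by
      intro i
      have := hJ i
      rcases h0 : σ (i, 0) with ⟨a, s⟩
      rcases h1 : σ (i, 1) with ⟨b, t⟩
      rw [h0, h1] at this
      clear_value F
      fin_cases s <;> fin_cases t
      · exact absurd (h00 a b) this
      · refine ⟨?_, by simp⟩
        by_contra hab
        exact this ((h01 a b).trans (if_neg fun h => hab h.symm))
      · refine ⟨?_, by simp⟩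
        by_contra hab
        exact this ((h10 a b).trans (if_neg fun h => hab h.symm))
      · exact absurd (h11 a b) this
    have hϖ : Function.Injective fun i => (σ (i, 0)).1 := by
      intro i j hij
      simp only at hij
      by_cases h2 : (σ (i, 0)).2 = (σ (j, 0)).2
      · have := σ.injective (Prod.ext hij h2)
        exact congrArg Prod.fst this
      · have h3 : (σ (i, 0)).2 = (σ (j, 1)).2 := by
          rw [(hpair j).2]
          generalize (σ (i, 0)).2 = s at h2
          generalize (σ (j, 0)).2 = t at h2
          revert s t; decide
        have := σ.injective (Prod.ext (hij.trans (hpair j).1.symm) h3)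
        exact congrArg Prod.fst this
    let ϖ : Equiv.Perm κ := Equiv.ofBijective _ (Finite.injective_iff_bijective.1 hϖ)
    let τ : κ → Equiv.Perm (Fin 2) := fun i => Equiv.swap 0 (σ (i, 0)).2
    refine Finset.mem_image.2 ⟨(ϖ, τ), Finset.mem_univ _, ?_⟩
    ext1 ⟨i, b⟩
    rw [hF]
    fin_cases b
    · simp [ϖ, τ]
    · refine Prod.ext ?_ ?_
      · simp [ϖ, (hpair i).1]
      · simp only [τ, Fin.mk_one, (hpair i).2]
        generalize (σ (i, 0)).2 = s
        revert s; decide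
  rw [← Finset.sum_subset (Finset.subset_univ (Finset.univ.image F)) hout,
    Finset.sum_image hinj.injOn, Finset.sum_congr rfl fun p _ => hterm p]
  simp only [Finset.sum_const, Finset.card_univ, Fintype.card_prod, Fintype.card_perm,
    Fintype.card_pi, Fintype.card_fin, Finset.prod_const, nsmul_eq_mul]
  push_cast [Nat.factorial]
  ring

/-- The value of `α ∧ β^m` on a frame adapted to `α` and symplectic for `β`. -/
theorem wedgeSum_symplectic (α : V →ₗ[ℝ] ℝ) (β : V →ₗ[ℝ] V →ₗ[ℝ] ℝ) (v : Option (κ × Fin 2) → V)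
    (hα : ∀ s, α (v (some s)) = 0)
    (h00 : ∀ a b, β (v (some (a, 0))) (v (some (b, 0))) = 0)
    (h11 : ∀ a b, β (v (some (a, 1))) (v (some (b, 1))) = 0)
    (h01 : ∀ a b, β (v (some (a, 0))) (v (some (b, 1))) = if a = b then -1 else 0)
    (h10 : ∀ a b, β (v (some (a, 1))) (v (some (b, 0))) = if a = b then 1 else 0) :
    wedgeSum κ α β v = α (v none) *
      ((-1) ^ Fintype.card κ * (Fintype.card κ).factorial * 2 ^ Fintype.card κ) := by
  rw [wedgeSum_apply, ← Equiv.Perm.decomposeOption.symm.sum_comp, Fintype.sum_prod_type,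
    Finset.sum_eq_single none]
  · rw [← sum_perm_prod_symplectic (fun a b => β (v (some a)) (v (some b))) h00 h11 h01 h10,
      Finset.mul_sum]
    refine Finset.sum_congr rfl fun σ _ => ?_
    simp only [Equiv.Perm.decomposeOption_symm_sign, Equiv.Perm.decomposeOption_symm_of_none_apply,
      Option.map_none, Option.map_some]
    ring
  · rintro (_ | s) _ h
    · exact absurd rfl h
    · refine Finset.sum_eq_zero fun σ _ => ?_
      simp [hα]
  · simp

end WedgePowers

/-! ### The canonical forms on frames -/

section FormValues

variable {n : ℕ}

theorem canonicalForm_apply (z X : PhaseSpace n) :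
    canonicalForm z X = inner ℝ z.2 X.1 := rfl

theorem symplecticForm_apply (z X Y : PhaseSpace n) :
    symplecticForm z X Y = inner ℝ X.2 Y.1 - inner ℝ Y.2 X.1 := by
  let A : PhaseSpace n →L[ℝ] PhaseSpace n →L[ℝ] ℝ :=
    ((ContinuousLinearMap.compL ℝ (PhaseSpace n) (Euc n) ℝ).flip
      (ContinuousLinearMap.fst ℝ (Euc n) (Euc n))).comp
        ((innerSL ℝ).comp (ContinuousLinearMap.snd ℝ (Euc n) (Euc n)))
  have hA : (canonicalForm (n := n)) = A := rfl
  rw [symplecticForm, hA, A.fderiv]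
  rfl

/-- The symplectic form as a bilinear map; in canonical coordinates it is constant. -/
noncomputable def symplecticBilin (n : ℕ) : PhaseSpace n →ₗ[ℝ] PhaseSpace n →ₗ[ℝ] ℝ :=
  LinearMap.mk₂ ℝ (fun X Y => inner ℝ X.2 Y.1 - inner ℝ Y.2 X.1)
    (fun X X' Y => by simp only [Prod.snd_add, Prod.fst_add, inner_add_left, inner_add_right]; ring)
    (fun c X Y => by
      simp only [Prod.smul_snd, Prod.smul_fst, real_inner_smul_left, real_inner_smul_right,
        smul_eq_mul]
      ring)
    (fun X Y Y' => by simp only [Prod.snd_add, Prod.fst_add, inner_add_left, inner_add_right]; ring)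
    (fun c X Y => by
      simp only [Prod.smul_snd, Prod.smul_fst, real_inner_smul_left, real_inner_smul_right,
        smul_eq_mul]
      ring)

theorem symplecticBilin_apply (X Y : PhaseSpace n) :
    symplecticBilin n X Y = inner ℝ X.2 Y.1 - inner ℝ Y.2 X.1 := rfl

/-- The Liouville form is the Lebesgue measure in canonical coordinates. -/
theorem abs_liouvilleForm_coordFrame (z : PhaseSpace n) : |liouvilleForm z coordFrame| = 1 := by
  have h := sum_perm_prod_symplectic (κ := Fin n)
    (fun s t => symplecticForm z (coordFrame s) (coordFrame t))
    (fun a b => by simp [symplecticForm_apply, coordFrame])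
    (fun a b => by simp [symplecticForm_apply, coordFrame])
    (fun a b => by
      simp [symplecticForm_apply, coordFrame, EuclideanSpace.inner_single_left,
        eq_comm]
      split_ifs <;> simp)
    (fun a b => by
      simp [symplecticForm_apply, coordFrame, EuclideanSpace.inner_single_left,
        eq_comm])
  have h' : liouvilleForm z coordFrame = (-1) ^ n := by
    rw [liouvilleForm, h, Fintype.card_fin]
    have : (n.factorial : ℝ) ≠ 0 := by positivity
    field_simp
  rw [h', abs_pow]
  simp

theorem omegaForm_eq_wedgeSum (z : PhaseSpace n) (v : Option (Fin (n - 1) × Fin 2) → PhaseSpace n) :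
    omegaForm z v = (1 / (n.factorial * 2 ^ (n - 1) : ℝ)) *
      wedgeSum (Fin (n - 1)) (canonicalForm z : PhaseSpace n →ₗ[ℝ] ℝ) (symplecticBilin n) v := by
  rw [wedgeSum_apply, omegaForm]
  simp only [symplecticForm_apply, symplecticBilin_apply]
  rfl

/-- The vectors `θ` and `sphereFrame θ` together form an orthonormal basis. -/
theorem exists_orthonormalBasis_sphereFrame [NeZero n] (θ : Metric.sphere (0 : Euc n) 1) :
    ∃ b : OrthonormalBasis (Fin n) ℝ (Euc n), b 0 = θ ∧
      ∀ i : Fin (n - 1), b ⟨i.1 + 1, by omega⟩ = (sphereFrame θ i : Euc n) := by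
  have hτθ : ∀ i, inner ℝ (θ : Euc n) (sphereFrame θ i : Euc n) = 0 := fun i =>
    (Submodule.mem_orthogonal_singleton_iff_inner_right.1 (sphereFrame θ i).2)
  have hττ : ∀ i j, inner ℝ (sphereFrame θ i : Euc n) (sphereFrame θ j : Euc n) =
      if i = j then (1 : ℝ) else 0 := fun i j => by
    rw [← Submodule.coe_inner]
    exact orthonormal_iff_ite.1 (sphereFrame θ).orthonormal i j
  let u : Fin n → Euc n := fun k =>
    if h : k.1 = 0 then θ else (sphereFrame θ ⟨k.1 - 1, by omega⟩ : Euc n)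
  have hu : Orthonormal ℝ u := by
    rw [orthonormal_iff_ite]
    rintro ⟨k, hk⟩ ⟨l, hl⟩
    simp only [u, Fin.mk.injEq]
    by_cases hk0 : k = 0 <;> by_cases hl0 : l = 0
    · simp [hk0, hl0]
    · simp [hk0, hl0, hτθ, Ne.symm hl0]
    · rw [real_inner_comm]
      simp [hk0, hl0, hτθ]
    · simp only [hk0, hl0, dite_false, hττ, Fin.mk.injEq]
      congr 1
      simp only [eq_iff_iff]
      omega
  obtain ⟨b, hb⟩ := Orthonormal.exists_orthonormalBasis_extension_of_card_eq (𝕜 := ℝ) (v := u)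
    (s := univ) (by simp) (hu.comp Subtype.val Subtype.val_injective)
  refine ⟨b, ?_, fun i => ?_⟩
  · rw [hb 0 (mem_univ _)]; simp [u]
  · rw [hb _ (mem_univ _)]; simp [u]

/-- The arrangement of `n` base vectors and `n - 1` fibre vectors as a family of `2 n - 1` vectors
which `productFrame` uses: `none` and the slots `(i, 0)` take the base vectors. -/
noncomputable def slotEquiv (n : ℕ) [NeZero n] :
    Option (Fin (n - 1) × Fin 2) ≃ Fin n ⊕ Fin (n - 1) :=
  Equiv.ofBijective
    (fun
      | none => Sum.inl 0
      | some (i, b) => if b = 0 then Sum.inl ⟨i.1 + 1, by omega⟩ else Sum.inr i)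
    (by
      rw [Fintype.bijective_iff_injective_and_card]
      constructor
      · rintro (_ | ⟨i, b⟩) (_ | ⟨j, c⟩) h
        · rfl
        · fin_cases c <;> simp [Fin.ext_iff] at h
        · fin_cases b <;> simp [Fin.ext_iff] at h
        · fin_cases b <;> fin_cases c <;> simp_all [Fin.ext_iff]
      · have := NeZero.pos n
        simp
        omega)

theorem slotEquiv_none [NeZero n] : slotEquiv n none = Sum.inl 0 := rfl

theorem slotEquiv_some_zero [NeZero n] (i : Fin (n - 1)) :
    slotEquiv n (some (i, 0)) = Sum.inl ⟨i.1 + 1, by omega⟩ := rfl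

theorem slotEquiv_some_one [NeZero n] (i : Fin (n - 1)) :
    slotEquiv n (some (i, 1)) = Sum.inr i := rfl

/-- The value of `α ∧ (dα)^{n-1}` at a unit covector on the frame `∂/∂q_i`, `sphereFrame`. Replacing
`∂/∂q_i` by the orthonormal basis which consists of `θ` and `sphereFrame θ` changes the value at
most by a sign, and the new frame is symplectic. -/
theorem abs_wedgeSum_productFrame [NeZero n] (q : Euc n) (θ : Metric.sphere (0 : Euc n) 1) :
    |wedgeSum (Fin (n - 1)) (canonicalForm (q, (θ : Euc n)) : PhaseSpace n →ₗ[ℝ] ℝ)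
      (symplecticBilin n) (productFrame θ)| = (n - 1).factorial * 2 ^ (n - 1) := by
  obtain ⟨b, hb0, hb⟩ := exists_orthonormalBasis_sphereFrame θ
  have hτθ : ∀ i, inner ℝ (θ : Euc n) (sphereFrame θ i : Euc n) = 0 := fun i =>
    (Submodule.mem_orthogonal_singleton_iff_inner_right.1 (sphereFrame θ i).2)
  have hττ : ∀ i j, inner ℝ (sphereFrame θ i : Euc n) (sphereFrame θ j : Euc n) =
      if i = j then (1 : ℝ) else 0 := fun i j => by
    rw [← Submodule.coe_inner]
    exact orthonormal_iff_ite.1 (sphereFrame θ).orthonormal i j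
  let T : WithLp 2 (Euc n × (Submodule.span ℝ {(θ : Euc n)})ᗮ) →ₗ[ℝ] PhaseSpace n :=
    (LinearMap.prodMap LinearMap.id (Submodule.subtype _)) ∘ₗ
      (WithLp.linearEquiv 2 ℝ (Euc n × (Submodule.span ℝ {(θ : Euc n)})ᗮ)).toLinearMap
  let e₁ := ((EuclideanSpace.basisFun (Fin n) ℝ).prod (sphereFrame θ)).reindex (slotEquiv n).symm
  let e₂ := (b.prod (sphereFrame θ)).reindex (slotEquiv n).symm
  set f := wedgeSum (Fin (n - 1)) (canonicalForm (q, (θ : Euc n)) : PhaseSpace n →ₗ[ℝ] ℝ)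
    (symplecticBilin n) with hf
  have h₁ : (fun j => T (e₁ j)) = productFrame θ := by
    funext j
    rcases j with _ | ⟨i, c⟩
    · simp [T, e₁, slotEquiv_none, productFrame]
    · fin_cases c
      · simp [T, e₁, slotEquiv_some_zero, productFrame]
      · simp [T, e₁, slotEquiv_some_one, productFrame]
  have h₂n : T (e₂ none) = ((θ : Euc n), 0) := by simp [T, e₂, slotEquiv_none, hb0]
  have h₂0 : ∀ i, T (e₂ (some (i, 0))) = ((sphereFrame θ i : Euc n), 0) := fun i => by
    simp [T, e₂, slotEquiv_some_zero, hb]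
  have h₂1 : ∀ i, T (e₂ (some (i, 1))) = (0, (sphereFrame θ i : Euc n)) := fun i => by
    simp [T, e₂, slotEquiv_some_one]
  have hval : f (fun j => T (e₂ j)) = (-1) ^ (n - 1) * (n - 1).factorial * 2 ^ (n - 1) := by
    rw [hf, wedgeSum_symplectic]
    · simp [h₂n, canonicalForm_apply]
    · rintro ⟨i, c⟩
      fin_cases c
      · simp [h₂0, canonicalForm_apply, hτθ]
      · simp [h₂1, canonicalForm_apply]
    · intro i j; simp [h₂0, symplecticBilin_apply]
    · intro i j; simp [h₂1, symplecticBilin_apply]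
    · intro i j
      simp only [h₂0, h₂1, symplecticBilin_apply, hττ, inner_zero_right]
      simp only [eq_comm (a := j)]
      split_ifs <;> simp
    · intro i j
      simp only [h₂0, h₂1, symplecticBilin_apply, hττ, inner_zero_right, sub_zero]
  have hdet := (f.compLinearMap T).eq_smul_basis_det e₂.toBasis
  have happ : f (productFrame θ) = f (fun j => T (e₂ j)) * e₂.toBasis.det e₁ := by
    rw [← h₁]
    have := congrArg (fun g => g e₁) hdet
    simpa [AlternatingMap.compLinearMap_apply, Function.comp_def] using this
  have hone : |e₂.toBasis.det e₁| = 1 := by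
    rcases e₂.det_to_matrix_orthonormalBasis_real e₁ with h | h <;> simp [h]
  rw [happ, abs_mul, hone, hval]
  simp [abs_mul]

/-- The form `Ω` at `(q, ρ θ)`, on the images of the frame of `ℝ^n × S^{n-1}` under
`(q, θ) ↦ (q, ρ(q, θ) θ)`. The derivatives of `ρ`, which enter as the coefficients `a`, do not
contribute. -/
theorem abs_omegaForm_radial [NeZero n] (q : Euc n) (θ : Metric.sphere (0 : Euc n) 1) (ρ : ℝ)
    (hρ : 0 ≤ ρ) (a : Option (Fin (n - 1) × Fin 2) → ℝ) :
    |omegaForm (q, ρ • (θ : Euc n)) fun j =>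
      ((productFrame θ j).1, ρ • (productFrame θ j).2 + a j • (θ : Euc n))| = ρ ^ n / n := by
  have hn : n = n - 1 + 1 := (Nat.succ_pred_eq_of_pos (NeZero.pos n)).symm
  have hsplit : (fun j => ((productFrame θ j).1, ρ • (productFrame θ j).2 + a j • (θ : Euc n))) =
      fun j => ((productFrame θ j).1, ρ • (productFrame θ j).2) +
        a j • ((0, (θ : Euc n)) : PhaseSpace n) := by
    funext j; simp
  -- multiplying all fibre coordinates by `ρ` multiplies both `α` and `dα` by `ρ`
  have hscale : wedgeSum (Fin (n - 1)) (canonicalForm (q, ρ • (θ : Euc n)) : PhaseSpace n →ₗ[ℝ] ℝ)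
        (symplecticBilin n) (fun j => ((productFrame θ j).1, ρ • (productFrame θ j).2)) =
      ρ ^ n * wedgeSum (Fin (n - 1)) (canonicalForm (q, (θ : Euc n)) : PhaseSpace n →ₗ[ℝ] ℝ)
        (symplecticBilin n) (productFrame θ) := by
    rw [wedgeSum_apply, wedgeSum_apply, Finset.mul_sum]
    refine Finset.sum_congr rfl fun σ _ => ?_
    have hprod : ∏ i : Fin (n - 1),
          symplecticBilin n ((productFrame θ (σ (some (i, 0)))).1,
            ρ • (productFrame θ (σ (some (i, 0)))).2) ((productFrame θ (σ (some (i, 1)))).1,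
            ρ • (productFrame θ (σ (some (i, 1)))).2) =
        ρ ^ (n - 1) * ∏ i : Fin (n - 1),
          symplecticBilin n (productFrame θ (σ (some (i, 0))))
            (productFrame θ (σ (some (i, 1)))) := by
      rw [show ρ ^ (n - 1) = ∏ _i : Fin (n - 1), ρ by simp, ← Finset.prod_mul_distrib]
      refine Finset.prod_congr rfl fun i _ => ?_
      simp only [symplecticBilin_apply, real_inner_smul_left]
      ring
    rw [hprod, show ρ ^ n = ρ ^ (n - 1) * ρ by rw [← pow_succ, ← hn]]
    simp only [ContinuousLinearMap.coe_coe, canonicalForm_apply, real_inner_smul_left]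
    ring
  rw [hsplit, omegaForm_eq_wedgeSum]
  rcases eq_or_lt_of_le hρ with h0 | hpos
  · have hz : wedgeSum (Fin (n - 1)) (canonicalForm (q, ρ • (θ : Euc n)) : PhaseSpace n →ₗ[ℝ] ℝ)
        (symplecticBilin n) (fun j => ((productFrame θ j).1, ρ • (productFrame θ j).2) +
          a j • ((0, (θ : Euc n)) : PhaseSpace n)) = 0 := by
      rw [wedgeSum_apply]
      refine Finset.sum_eq_zero fun σ _ => ?_
      simp [canonicalForm_apply, ← h0]
    rw [hz, ← h0, zero_pow (NeZero.ne n)]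
    simp
  · rw [wedgeSum_add_smul _ _ _ ρ⁻¹, hscale, abs_mul, abs_mul, abs_wedgeSum_productFrame,
      abs_of_nonneg (by positivity : (0 : ℝ) ≤ 1 / (n.factorial * 2 ^ (n - 1))),
      abs_of_nonneg (by positivity : (0 : ℝ) ≤ ρ ^ n)]
    · have h1 : (n.factorial : ℝ) = n * (n - 1).factorial := by
        conv_lhs => rw [hn, Nat.factorial_succ, ← hn]
        push_cast; rfl
      have h2 : (n : ℝ) ≠ 0 := NeZero.ne _
      have h3 : ((n - 1).factorial : ℝ) ≠ 0 := by positivity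
      rw [h1]
      field_simp
    · simp [canonicalForm_apply]
    · intro u
      simp [canonicalForm_apply, symplecticBilin_apply, real_inner_smul_left, hpos.ne']
    · intro u
      simp [canonicalForm_apply, symplecticBilin_apply, real_inner_smul_left, hpos.ne']

end FormValues

/-! ### The Hamiltonian as a support function -/

section Hamiltonians

variable {n : ℕ} {B : Type*} [TopologicalSpace B] {I : ModelWithCorners ℝ (Euc n) B}
  {M : Type*} [TopologicalSpace M] [ChartedSpace B M]

theorem symm_mem_source (x₀ : M) {q : Euc n} (hq : q ∈ (extChartAt I x₀).target) :
    (extChartAt I x₀).symm q ∈ (chartAt B x₀).source := by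
  rw [← extChartAt_source I]
  exact (extChartAt I x₀).map_target hq

variable [IsManifold I ∞ M]

/-- The Lagrangian in the coordinates `(q, w)` of the tangent bundle which the chart of `M` around
`x₀` induces. -/
noncomputable def lagrangianCoord (L : FinslerMetric I M) (x₀ : M) (z : Euc n × Euc n) : ℝ :=
  L.toFun ⟨(extChartAt I x₀).symm z.1,
    (trivializationAt (Euc n) (TangentSpace I) x₀).symmL ℝ ((extChartAt I x₀).symm z.1) z.2⟩

/-- The Hamiltonian in the canonical coordinates `(q, p)` which the chart of `M` around `x₀`
induces. -/
noncomputable def hamiltonianCoord (L : FinslerMetric I M) (x₀ : M) (z : PhaseSpace n) : ℝ :=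
  hamiltonian L (cotangentCoord I x₀ z)

theorem FinslerMetric.map_zero (L : FinslerMetric I M) (x : M) : L.toFun ⟨x, 0⟩ = 0 := by
  have h := L.homogeneous x 0 2 two_pos
  rw [smul_zero] at h
  linarith

variable (L : FinslerMetric I M) (x₀ : M)

theorem mem_baseSet {q : Euc n} (hq : q ∈ (extChartAt I x₀).target) :
    (extChartAt I x₀).symm q ∈ (trivializationAt (Euc n) (TangentSpace I) x₀).baseSet := by
  rw [TangentBundle.trivializationAt_baseSet]
  exact symm_mem_source x₀ hq

/-- The coordinates `(q, p)` and `(q, w)` of covectors and vectors are dual to each other. -/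
theorem cotangentCoord_symmL {q : Euc n} (hq : q ∈ (extChartAt I x₀).target) (p w : Euc n) :
    (cotangentCoord I x₀ (q, p)).2
      ((trivializationAt (Euc n) (TangentSpace I) x₀).symmL ℝ ((extChartAt I x₀).symm q) w) =
    inner ℝ p w := by
  have h1 := Trivialization.continuousLinearMapAt_symmL (R := ℝ)
    (trivializationAt (Euc n) (TangentSpace I) x₀) (mem_baseSet x₀ hq) w
  rw [TangentBundle.continuousLinearMapAt_trivializationAt (symm_mem_source x₀ hq)] at h1
  exact congrArg (fun y => inner ℝ p y) h1

theorem exists_symmL_eq {q : Euc n} (hq : q ∈ (extChartAt I x₀).target)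
    (u : TangentSpace I ((extChartAt I x₀).symm q)) :
    ∃ y, (trivializationAt (Euc n) (TangentSpace I) x₀).symmL ℝ ((extChartAt I x₀).symm q) y = u :=
  ⟨_, Trivialization.symmL_continuousLinearMapAt (R := ℝ)
    (trivializationAt (Euc n) (TangentSpace I) x₀) (mem_baseSet x₀ hq) u⟩

theorem symmL_ne_zero {q : Euc n} (hq : q ∈ (extChartAt I x₀).target) {w : Euc n} (hw : w ≠ 0) :
    (trivializationAt (Euc n) (TangentSpace I) x₀).symmL ℝ ((extChartAt I x₀).symm q) w ≠ 0 := by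
  intro h
  have h1 := Trivialization.continuousLinearMapAt_symmL (R := ℝ)
    (trivializationAt (Euc n) (TangentSpace I) x₀) (mem_baseSet x₀ hq) w
  rw [h, map_zero] at h1
  exact hw h1.symm

theorem lagrangianCoord_pos {q : Euc n} (hq : q ∈ (extChartAt I x₀).target) {w : Euc n}
    (hw : w ≠ 0) : 0 < lagrangianCoord L x₀ (q, w) :=
  L.pos _ (symmL_ne_zero x₀ hq hw)

theorem lagrangianCoord_smul (q w : Euc n) {t : ℝ} (ht : 0 < t) :
    lagrangianCoord L x₀ (q, t • w) = t * lagrangianCoord L x₀ (q, w) := by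
  simp only [lagrangianCoord, map_smul]
  exact L.homogeneous _ _ t ht

theorem contDiffOn_lagrangianCoord :
    ContDiffOn ℝ ∞ (lagrangianCoord L x₀) ((extChartAt I x₀).target ×ˢ {0}ᶜ) := by
  let e := trivializationAt (Euc n) (TangentSpace I (M := M)) x₀
  have h1 : ContMDiffOn (I.prod 𝓘(ℝ, Euc n)) I.tangent ∞ e.toOpenPartialHomeomorph.symm e.target :=
    e.contMDiffOn_symm
  have h2 : ContMDiffOn 𝓘(ℝ, Euc n × Euc n) (I.prod 𝓘(ℝ, Euc n)) ∞
      (fun z : Euc n × Euc n => ((extChartAt I x₀).symm z.1, z.2))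
      ((extChartAt I x₀).target ×ˢ {0}ᶜ) :=
    ((contMDiffOn_extChartAt_symm x₀).comp contDiff_fst.contMDiff.contMDiffOn
      fun z hz => hz.1).prodMk contDiff_snd.contMDiff.contMDiffOn
  have h3 := h1.comp h2 fun z hz => e.mem_target.2 (mem_baseSet x₀ hz.1)
  have h4 : EqOn (lagrangianCoord L x₀) (L.toFun ∘ e.toOpenPartialHomeomorph.symm ∘
      fun z : Euc n × Euc n => ((extChartAt I x₀).symm z.1, z.2))
      ((extChartAt I x₀).target ×ˢ {0}ᶜ) := fun z hz => by
    have hb := mem_baseSet (I := I) x₀ hz.1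
    simp only [Function.comp_apply, lagrangianCoord]
    rw [Trivialization.symmL_apply (R := ℝ) (hb := hb), ← Trivialization.mk_symm e hb]
  refine contMDiffOn_iff_contDiffOn.1 ((L.smooth.comp h3 fun z hz => ?_).congr h4)
  have hb := mem_baseSet (I := I) x₀ hz.1
  have h5 := symmL_ne_zero (I := I) x₀ hz.1 hz.2
  rw [Trivialization.symmL_apply (R := ℝ) (hb := hb)] at h5
  simp only [mem_ofPred_eq, Function.comp_apply, mem_preimage]
  rw [← Trivialization.mk_symm e hb]
  exact h5

theorem continuousOn_lagrangianCoord :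
    ContinuousOn (lagrangianCoord L x₀) ((extChartAt I x₀).target ×ˢ {0}ᶜ) :=
  (contDiffOn_lagrangianCoord L x₀).continuousOn

theorem continuousOn_inner_div_lagrangianCoord {q : Euc n} (hq : q ∈ (extChartAt I x₀).target)
    (p : Euc n) : ContinuousOn (fun w => inner ℝ p w / lagrangianCoord L x₀ (q, w))
      (Metric.sphere 0 1) := by
  refine ContinuousOn.div (by fun_prop) ?_ fun w hw =>
    (lagrangianCoord_pos L x₀ hq (ne_zero_of_mem_unit_sphere ⟨w, hw⟩)).ne'
  exact (continuousOn_lagrangianCoord L x₀).comp (f := fun w => (q, w)) (by fun_prop)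
    fun w hw => ⟨hq, ne_zero_of_mem_unit_sphere ⟨w, hw⟩⟩

/-- The Hamiltonian is the support function of the unit ball of `L`. A maximum point of
`ξ / L`, suitably scaled, is a preimage of `ξ` under the Legendre transform. -/
theorem isGreatest_hamiltonianCoord [NeZero n] {q : Euc n} (hq : q ∈ (extChartAt I x₀).target)
    (p : Euc n) :
    IsGreatest ((fun w => inner ℝ p w / lagrangianCoord L x₀ (q, w)) '' Metric.sphere 0 1)
      (hamiltonianCoord L x₀ (q, p)) := by
  have hpos : ∀ w ∈ Metric.sphere (0 : Euc n) 1, 0 < lagrangianCoord L x₀ (q, w) := fun w hw =>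
    lagrangianCoord_pos L x₀ hq (ne_zero_of_mem_unit_sphere ⟨w, hw⟩)
  obtain ⟨w₀, hw₀, hmax⟩ := (isCompact_sphere (0 : Euc n) 1).exists_isMaxOn
    (NormedSpace.sphere_nonempty.2 zero_le_one) (continuousOn_inner_div_lagrangianCoord L x₀ hq p)
  set m := inner ℝ p w₀ / lagrangianCoord L x₀ (q, w₀) with hm
  have hle : ∀ w ∈ Metric.sphere (0 : Euc n) 1, inner ℝ p w ≤ m * lagrangianCoord L x₀ (q, w) :=
    fun w hw => (div_le_iff₀ (hpos w hw)).1 (hmax hw)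
  have hmw : m * lagrangianCoord L x₀ (q, w₀) = inner ℝ p w₀ :=
    div_mul_cancel₀ _ (hpos w₀ hw₀).ne'
  have hm0 : 0 ≤ m := by
    -- otherwise `-w₀` would give a larger value
    have hw₁ : -w₀ ∈ Metric.sphere (0 : Euc n) 1 := by simpa using hw₀
    have h1 := hle _ hw₁
    rw [inner_neg_right, ← hmw] at h1
    have h2 := hpos _ hw₀
    have h3 := hpos _ hw₁
    by_contra hneg
    push Not at hneg
    nlinarith
  set x := (extChartAt I x₀).symm q with hx
  let S := (trivializationAt (Euc n) (TangentSpace I) x₀).symmL ℝ x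
  have hLS : ∀ y, L.toFun ⟨x, S y⟩ = lagrangianCoord L x₀ (q, y) := fun y => rfl
  have hSm : ∀ (c : ℝ) y, S (c • y) = c • S y := fun c y => map_smul S c y
  -- the multiple of `w₀` on which `L` takes the value `m`
  set c := m / lagrangianCoord L x₀ (q, w₀) with hc
  have hLv : L.toFun ⟨x, S (c • w₀)⟩ = m := by
    rcases eq_or_lt_of_le hm0 with h0 | h0
    · rw [show c = 0 by rw [hc, ← h0, zero_div], zero_smul, map_zero, L.map_zero, h0]
    · rw [hLS, lagrangianCoord_smul L x₀ q w₀ (div_pos h0 (hpos _ hw₀))]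
      exact div_mul_cancel₀ _ (hpos w₀ hw₀).ne'
  have hleg : IsLegendre L x (S (c • w₀)) (cotangentCoord I x₀ (q, p)).2 := by
    refine ⟨?_, fun u => ?_⟩
    · rw [hLv]
      refine (cotangentCoord_symmL x₀ hq p _).trans ?_
      rw [real_inner_smul_right, ← hmw, hc]
      have := (hpos w₀ hw₀).ne'
      field_simp
    · obtain ⟨y, hy⟩ := exists_symmL_eq x₀ hq u
      rw [hLv, ← hy]
      refine (cotangentCoord_symmL x₀ hq p _).trans_le ?_
      change inner ℝ p y ≤ m * lagrangianCoord L x₀ (q, y)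
      rcases eq_or_ne y 0 with h0 | h0
      · rw [h0, inner_zero_right]
        exact mul_nonneg hm0 (L.nonneg _)
      · have hy' : 0 < ‖y‖ := norm_pos_iff.2 h0
        have h1 := hle (‖y‖⁻¹ • y) (by simp [norm_smul, h0])
        rw [lagrangianCoord_smul L x₀ q y (inv_pos.2 hy'), real_inner_smul_right] at h1
        have h2 : ‖y‖⁻¹ * inner ℝ p y ≤ ‖y‖⁻¹ * (m * lagrangianCoord L x₀ (q, y)) := by linarith
        exact le_of_mul_le_mul_left h2 (inv_pos.2 hy')
  have hH : hamiltonianCoord L x₀ (q, p) = m := (hamiltonian_eq_of_isLegendre L hleg).trans hLv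
  rw [hH]
  exact ⟨⟨w₀, hw₀, rfl⟩, by rintro _ ⟨w, hw, rfl⟩; exact hmax hw⟩

theorem hamiltonianCoord_smul [NeZero n] {q : Euc n} (hq : q ∈ (extChartAt I x₀).target)
    (p : Euc n) {t : ℝ} (ht : 0 ≤ t) :
    hamiltonianCoord L x₀ (q, t • p) = t * hamiltonianCoord L x₀ (q, p) := by
  have h1 := isGreatest_hamiltonianCoord L x₀ hq p
  refine (isGreatest_hamiltonianCoord L x₀ hq (t • p)).unique ⟨?_, ?_⟩
  · obtain ⟨w, hw, h⟩ := h1.1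
    refine ⟨w, hw, ?_⟩
    simp only [real_inner_smul_left] at h ⊢
    rw [mul_div_assoc, h]
  · rintro _ ⟨w, hw, rfl⟩
    simp only [real_inner_smul_left]
    rw [mul_div_assoc]
    exact mul_le_mul_of_nonneg_left (h1.2 ⟨w, hw, rfl⟩) ht

theorem one_div_lagrangianCoord_le [NeZero n] {q : Euc n} (hq : q ∈ (extChartAt I x₀).target)
    {θ : Euc n} (hθ : θ ∈ Metric.sphere (0 : Euc n) 1) :
    1 / lagrangianCoord L x₀ (q, θ) ≤ hamiltonianCoord L x₀ (q, θ) := by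
  refine (isGreatest_hamiltonianCoord L x₀ hq θ).2 ⟨θ, hθ, ?_⟩
  have : ‖θ‖ = 1 := by simpa using hθ
  simp [this]

theorem hamiltonianCoord_pos [NeZero n] {q : Euc n} (hq : q ∈ (extChartAt I x₀).target)
    {p : Euc n} (hp : p ≠ 0) : 0 < hamiltonianCoord L x₀ (q, p) := by
  have hn : 0 < ‖p‖ := norm_pos_iff.2 hp
  have hθ : ‖p‖⁻¹ • p ∈ Metric.sphere (0 : Euc n) 1 := by simp [norm_smul, hp]
  have h1 := one_div_lagrangianCoord_le L x₀ hq hθ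
  have h2 := lagrangianCoord_pos L x₀ hq (ne_zero_of_mem_unit_sphere ⟨_, hθ⟩)
  rw [hamiltonianCoord_smul L x₀ hq p (inv_nonneg.2 hn.le)] at h1
  have h3 := (one_div_pos.2 h2).trans_le h1
  exact pos_of_mul_pos_right h3 (inv_nonneg.2 hn.le)

theorem continuousOn_hamiltonianCoord [NeZero n] :
    ContinuousOn (hamiltonianCoord L x₀) ((extChartAt I x₀).target ×ˢ univ) := by
  have hS : ∀ w : Metric.sphere (0 : Euc n) 1, (w : Euc n) ≠ 0 := ne_zero_of_mem_unit_sphere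
  let f : ((extChartAt I x₀).target ×ˢ (univ : Set (Euc n)) : Set (Euc n × Euc n)) →
      Metric.sphere (0 : Euc n) 1 → ℝ :=
    fun z w => inner ℝ z.1.2 (w : Euc n) / lagrangianCoord L x₀ (z.1.1, w)
  have hf : Continuous (Function.uncurry f) := by
    refine Continuous.div (by fun_prop) ?_ fun z =>
      (lagrangianCoord_pos L x₀ z.1.2.1 (hS z.2)).ne'
    exact (continuousOn_lagrangianCoord L x₀).comp_continuous
      (f := fun z : ((extChartAt I x₀).target ×ˢ (univ : Set (Euc n)) : Set (Euc n × Euc n)) ×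
        Metric.sphere (0 : Euc n) 1 => (z.1.1.1, (z.2 : Euc n))) (by fun_prop)
      fun z => ⟨z.1.2.1, hS z.2⟩
  have h := isCompact_univ.continuous_sSup (f := f) hf
  rw [continuousOn_iff_continuous_domRestrict]
  convert h using 2 with z
  have h1 := (isGreatest_hamiltonianCoord L x₀ z.2.1 z.1.2).csSup_eq
  refine h1.symm.trans (congrArg sSup ?_)
  ext y
  simp [f]

end Hamiltonians

/-! ### Polar coordinates -/

section PolarCoordinates

variable {n : ℕ}

theorem volumeIoiPow_apply_Iic (m : ℕ) (x : Ioi (0 : ℝ)) :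
    Measure.volumeIoiPow m (Iic x) = ENNReal.ofReal (x.1 ^ (m + 1) / (m + 1)) := by
  have h0 : Measure.volumeIoiPow m {x} = 0 := by
    refine withDensity_absolutelyContinuous _ _ ?_
    rw [(MeasurableEmbedding.subtype_coe measurableSet_Ioi).comap_apply]
    simp
  rw [← Iio_union_right, measure_congr (union_ae_eq_left_of_ae_eq_empty (ae_eq_empty.2 h0)),
    Measure.volumeIoiPow_apply_Iio]

/-- The measure `volumeIoiPow (n - 1)` of the radial variable is `r^{n-1} dr`. -/
theorem lintegral_eq_lintegral_sphere [NeZero n] {f : Euc n → ℝ≥0∞} (hf : Measurable f) :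
    ∫⁻ p, f p = ∫⁻ θ : Metric.sphere (0 : Euc n) 1, ∫⁻ r : Ioi (0 : ℝ), f (r.1 • (θ : Euc n))
      ∂(Measure.volumeIoiPow (n - 1)) ∂(volume : Measure (Euc n)).toSphere := by
  have hmp := (volume : Measure (Euc n)).measurePreserving_homeomorphUnitSphereProd
  rw [finrank_euclideanSpace_fin] at hmp
  have h1 : ∫⁻ p, f p = ∫⁻ p in ({0}ᶜ : Set (Euc n)), f p := by
    rw [restrict_compl_singleton]
  rw [h1, ← lintegral_subtype_comap (measurableSet_singleton _).compl, ← lintegral_prod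
    (fun z : Metric.sphere (0 : Euc n) 1 × Ioi (0 : ℝ) => f (z.2.1 • (z.1 : Euc n)))
    (by fun_prop), ← hmp.lintegral_comp_emb (Homeomorph.measurableEmbedding _)]
  refine lintegral_congr fun p => ?_
  congr 1
  have := (homeomorphUnitSphereProd (Euc n)).symm_apply_apply p
  exact (congrArg Subtype.val this).symm

/-- The volume of a star body in polar coordinates. -/
theorem lintegral_indicator_le_one [NeZero n] {h : Euc n → ℝ} (hc : Measurable h)
    (hpos : ∀ p, p ≠ 0 → 0 < h p) (hs : ∀ p (t : ℝ), 0 ≤ t → h (t • p) = t * h p) :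
    ∫⁻ p, {p | h p ≤ 1}.indicator 1 p =
      ∫⁻ θ : Metric.sphere (0 : Euc n) 1, ENNReal.ofReal ((h θ)⁻¹ ^ n / n)
        ∂(volume : Measure (Euc n)).toSphere := by
  rw [lintegral_eq_lintegral_sphere
    (measurable_one.indicator (measurableSet_le hc measurable_const))]
  refine lintegral_congr fun θ => ?_
  have hθ : 0 < h θ := hpos _ (ne_zero_of_mem_unit_sphere θ)
  have hn : n - 1 + 1 = n := Nat.succ_pred_eq_of_pos (NeZero.pos n)
  have h1 : ∀ r : Ioi (0 : ℝ), {p | h p ≤ 1}.indicator (1 : Euc n → ℝ≥0∞) (r.1 • (θ : Euc n)) =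
      (Iic (⟨(h θ)⁻¹, inv_pos.2 hθ⟩ : Ioi (0 : ℝ))).indicator 1 r := by
    intro r
    have : h (r.1 • (θ : Euc n)) ≤ 1 ↔ r ≤ (⟨(h θ)⁻¹, inv_pos.2 hθ⟩ : Ioi (0 : ℝ)) := by
      rw [hs _ _ (le_of_lt r.2), ← Subtype.coe_le_coe]
      change r.1 * h θ ≤ 1 ↔ r.1 ≤ (h θ)⁻¹
      rw [← one_div, le_div_iff₀ hθ]
    simp only [indicator, mem_ofPred_eq, mem_Iic, this, Pi.one_apply]
  simp only [h1]
  rw [lintegral_indicator_one measurableSet_Iic, volumeIoiPow_apply_Iic, hn]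
  congr 3
  rw [← Nat.cast_succ, Nat.succ_eq_add_one, hn]

end PolarCoordinates

/-! ### The volume of the codisc bundle as an integral over cospheres -/

section Volumes

variable {n : ℕ} {B : Type*} [TopologicalSpace B] {I : ModelWithCorners ℝ (Euc n) B}
  {M : Type*} [TopologicalSpace M] [ChartedSpace B M]

theorem measurableSet_extChartAt_target (x₀ : M) :
    MeasurableSet (extChartAt I x₀).target := by
  rw [extChartAt_target]
  exact ((chartAt B x₀).open_target.preimage I.continuous_symm).measurableSet.inter
    I.isClosed_range.measurableSet

theorem continuousOn_hamiltonianCoord_sphere [NeZero n] [IsManifold I ∞ M]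
    (L : FinslerMetric I M) (x₀ : M) :
    ContinuousOn (fun z : Euc n × Metric.sphere (0 : Euc n) 1 =>
      hamiltonianCoord L x₀ (z.1, z.2)) ((extChartAt I x₀).target ×ˢ univ) :=
  (continuousOn_hamiltonianCoord L x₀).comp
    (f := fun z : Euc n × Metric.sphere (0 : Euc n) 1 => (z.1, (z.2 : Euc n)))
    (by fun_prop) fun z hz => ⟨hz.1, mem_univ _⟩

theorem aemeasurable_hamiltonianCoord [NeZero n] [IsManifold I ∞ M]
    (L : FinslerMetric I M) (x₀ : M) :
    AEMeasurable (fun z : Euc n × Metric.sphere (0 : Euc n) 1 => hamiltonianCoord L x₀ (z.1, z.2))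
      (((volume : Measure (Euc n)).prod (volume : Measure (Euc n)).toSphere).restrict
        ((extChartAt I x₀).target ×ˢ univ)) :=
  (continuousOn_hamiltonianCoord_sphere L x₀).aemeasurable
    ((measurableSet_extChartAt_target x₀).prod .univ)

variable [IsManifold I ∞ M] [T2Space M] [CompactSpace M]

/-- The integral over `M`, in charts and with the partition of unity `chartPartition`, of the
integral of `f` over the Euclidean unit cospheres. Here `f x₀` is a nonnegative density, given in
the canonical coordinates which the chart around `x₀` induces. -/
noncomputable def cosphereIntegral (I : ModelWithCorners ℝ (Euc n) B) {M : Type*}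
    [TopologicalSpace M] [ChartedSpace B M] [IsManifold I ∞ M] [T2Space M] [CompactSpace M]
    (f : M → PhaseSpace n → ℝ) : ℝ≥0∞ :=
  ∑' x₀ : M, ∫⁻ z in (extChartAt I x₀).target ×ˢ (univ : Set (Metric.sphere (0 : Euc n) 1)),
    ENNReal.ofReal (chartPartition I M x₀ ((extChartAt I x₀).symm z.1)) *
      ENNReal.ofReal (f x₀ (z.1, z.2))
    ∂((volume : Measure (Euc n)).prod (volume : Measure (Euc n)).toSphere)

theorem cosphereIntegral_mono {f g : M → PhaseSpace n → ℝ}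
    (h : ∀ x₀, ∀ q ∈ (extChartAt I x₀).target, ∀ θ : Metric.sphere (0 : Euc n) 1,
      f x₀ (q, θ) ≤ g x₀ (q, θ)) : cosphereIntegral I f ≤ cosphereIntegral I g :=
  ENNReal.tsum_le_tsum fun x₀ => setLIntegral_mono'
    ((measurableSet_extChartAt_target x₀).prod .univ) fun z hz => by
      gcongr
      exact h x₀ z.1 hz.1 z.2

theorem continuousOn_chartPartition (x₀ : M) :
    ContinuousOn (fun q => chartPartition I M x₀ ((extChartAt I x₀).symm q))
      (extChartAt I x₀).target :=
  (chartPartition I M x₀).contMDiff.continuous.comp_continuousOn (continuousOn_extChartAt_symm x₀)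

theorem aemeasurable_chartPartition (x₀ : M) :
    AEMeasurable (fun z : Euc n × Metric.sphere (0 : Euc n) 1 =>
        ENNReal.ofReal (chartPartition I M x₀ ((extChartAt I x₀).symm z.1)))
      (((volume : Measure (Euc n)).prod (volume : Measure (Euc n)).toSphere).restrict
        ((extChartAt I x₀).target ×ˢ univ)) :=
  (((continuousOn_chartPartition x₀).comp continuousOn_fst fun _ hz => hz.1).aemeasurable
    ((measurableSet_extChartAt_target x₀).prod .univ)).ennreal_ofReal

variable [NeZero n]

theorem aemeasurable_chartPartition_mul (L : FinslerMetric I M) (x₀ : M) :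
    AEMeasurable (fun z : Euc n × Metric.sphere (0 : Euc n) 1 =>
        ENNReal.ofReal (chartPartition I M x₀ ((extChartAt I x₀).symm z.1)) *
          ENNReal.ofReal ((hamiltonianCoord L x₀ (z.1, z.2))⁻¹ ^ n / n))
      (((volume : Measure (Euc n)).prod (volume : Measure (Euc n)).toSphere).restrict
        ((extChartAt I x₀).target ×ˢ univ)) :=
  (aemeasurable_chartPartition x₀).mul
    (((aemeasurable_hamiltonianCoord L x₀).inv.pow_const n).div_const (n : ℝ)).ennreal_ofReal

/-- Integrating the Liouville measure along rays expresses the volume of the codisc bundle by an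
integral over cospheres. -/
theorem symplecticVolume_codisc (L : FinslerMetric I M) :
    symplecticVolume I (codisc (hamiltonian L)) =
      cosphereIntegral I fun x₀ z => (hamiltonianCoord L x₀ z)⁻¹ ^ n / n := by
  refine tsum_congr fun x₀ => ?_
  have hT := measurableSet_extChartAt_target (I := I) x₀
  have hTu : MeasurableSet ((extChartAt I x₀).target ×ˢ (univ : Set (Euc n))) := hT.prod .univ
  have hK := continuousOn_hamiltonianCoord L x₀
  have hKm : Measurable (((extChartAt I x₀).target ×ˢ univ).indicator (hamiltonianCoord L x₀)) := by
    classical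
    rw [← piecewise_eq_indicator]
    exact hK.measurable_piecewise continuousOn_const hTu
  have hχ : AEMeasurable (fun q => ENNReal.ofReal
      (chartPartition I M x₀ ((extChartAt I x₀).symm q)))
      (volume.restrict (extChartAt I x₀).target) :=
    ((continuousOn_chartPartition x₀).aemeasurable hT).ennreal_ofReal
  have hKs : ∀ q ∈ (extChartAt I x₀).target, Continuous fun p => hamiltonianCoord L x₀ (q, p) :=
    fun q hq => hK.comp_continuous (by fun_prop) fun p => ⟨hq, mem_univ _⟩
  calc ∫⁻ z in (extChartAt I x₀).target ×ˢ (univ : Set (Euc n)),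
        ENNReal.ofReal (chartPartition I M x₀ ((extChartAt I x₀).symm z.1)) *
          (codisc (hamiltonian L)).indicator 1 (cotangentCoord I x₀ z) *
          ENNReal.ofReal |liouvilleForm z coordFrame|
      = ∫⁻ z in (extChartAt I x₀).target ×ˢ (univ : Set (Euc n)),
        ENNReal.ofReal (chartPartition I M x₀ ((extChartAt I x₀).symm z.1)) *
          {z | ((extChartAt I x₀).target ×ˢ univ).indicator (hamiltonianCoord L x₀) z ≤ 1}.indicator
            1 z := by
        refine setLIntegral_congr_fun hTu fun z hz => ?_
        simp only [abs_liouvilleForm_coordFrame, ENNReal.ofReal_one, mul_one]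
        congr 1
        simp only [indicator, codisc, mem_ofPred_eq, if_pos hz, hamiltonianCoord, Pi.one_apply]
        congr
    _ = ∫⁻ q in (extChartAt I x₀).target, ∫⁻ p,
        ENNReal.ofReal (chartPartition I M x₀ ((extChartAt I x₀).symm q)) *
          {z | ((extChartAt I x₀).target ×ˢ univ).indicator (hamiltonianCoord L x₀) z ≤ 1}.indicator
            1 (q, p) := by
        rw [Measure.volume_eq_prod, ← Measure.prod_restrict, Measure.restrict_univ,
          lintegral_prod]
        exact hχ.comp_fst.mul
          (measurable_one.indicator (measurableSet_le hKm measurable_const)).aemeasurable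
    _ = ∫⁻ q in (extChartAt I x₀).target, ∫⁻ θ : Metric.sphere (0 : Euc n) 1,
        ENNReal.ofReal (chartPartition I M x₀ ((extChartAt I x₀).symm q)) *
          ENNReal.ofReal ((hamiltonianCoord L x₀ (q, θ))⁻¹ ^ n / n)
          ∂(volume : Measure (Euc n)).toSphere := by
        refine setLIntegral_congr_fun hT fun q hq => ?_
        have h1 : ∀ p, {z | ((extChartAt I x₀).target ×ˢ univ).indicator
              (hamiltonianCoord L x₀) z ≤ 1}.indicator (1 : PhaseSpace n → ℝ≥0∞) (q, p) =
            {p | hamiltonianCoord L x₀ (q, p) ≤ 1}.indicator 1 p := fun p => by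
          have : (q, p) ∈ (extChartAt I x₀).target ×ˢ (univ : Set (Euc n)) := ⟨hq, mem_univ _⟩
          simp only [indicator, mem_ofPred_eq, if_pos this, Pi.one_apply]
        simp only [h1]
        rw [lintegral_const_mul _ (measurable_one.indicator
            (measurableSet_le (hKs q hq).measurable measurable_const)),
          lintegral_indicator_le_one (hKs q hq).measurable
            (fun p hp => hamiltonianCoord_pos L x₀ hq hp)
            (fun p t ht => hamiltonianCoord_smul L x₀ hq p ht), lintegral_const_mul']
        exact ENNReal.ofReal_ne_top
    _ = _ := by
        rw [← Measure.prod_restrict, Measure.restrict_univ, lintegral_prod]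
        have h1 := aemeasurable_chartPartition_mul L x₀
        rwa [← Measure.prod_restrict, Measure.restrict_univ] at h1

end Volumes

/-! ### Finiteness and positivity of the volume -/

section FinitePositive

variable {n : ℕ} {B : Type*} [TopologicalSpace B] {I : ModelWithCorners ℝ (Euc n) B}
  {M : Type*} [TopologicalSpace M] [ChartedSpace B M] [IsManifold I ∞ M] [T2Space M]
  [CompactSpace M]

theorem chartPartition_isSubordinate :
    (chartPartition I M).IsSubordinate fun x => (chartAt B x).source :=
  Classical.choose_spec (SmoothPartitionOfUnity.exists_isSubordinate_chartAt_source I M)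

theorem finite_support_chartPartition :
    {x₀ : M | (Function.support (chartPartition I M x₀)).Nonempty}.Finite :=
  (chartPartition I M).locallyFinite.finite_nonempty_of_compact

variable [NeZero n]

/-- On the compact image of the support of a partition function, `1 / H` is bounded by the maximum
of `L` over unit vectors. -/
theorem setLIntegral_cosphere_lt_top (L : FinslerMetric I M) (x₀ : M) :
    ∫⁻ z in (extChartAt I x₀).target ×ˢ (univ : Set (Metric.sphere (0 : Euc n) 1)),
      ENNReal.ofReal (chartPartition I M x₀ ((extChartAt I x₀).symm z.1)) *
        ENNReal.ofReal ((hamiltonianCoord L x₀ (z.1, z.2))⁻¹ ^ n / n)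
      ∂((volume : Measure (Euc n)).prod (volume : Measure (Euc n)).toSphere) < ⊤ := by
  set C : Set (Euc n) := extChartAt I x₀ '' tsupport (chartPartition I M x₀) with hC
  have hsub : tsupport (chartPartition I M x₀) ⊆ (extChartAt I x₀).source := by
    rw [extChartAt_source]
    exact chartPartition_isSubordinate x₀
  have hCc : IsCompact C := (isClosed_tsupport _).isCompact.image_of_continuousOn
    ((continuousOn_extChartAt x₀).mono hsub)
  have hCt : C ⊆ (extChartAt I x₀).target := by
    rintro _ ⟨x, hx, rfl⟩
    exact (extChartAt I x₀).map_source (hsub hx)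
  obtain ⟨b, hb⟩ := (hCc.prod (isCompact_sphere (0 : Euc n) 1)).bddAbove_image
    ((continuousOn_lagrangianCoord L x₀).mono
      (prod_mono hCt fun w hw => ne_zero_of_mem_unit_sphere ⟨w, hw⟩))
  have hle : ∀ z ∈ (extChartAt I x₀).target ×ˢ (univ : Set (Metric.sphere (0 : Euc n) 1)),
      ENNReal.ofReal (chartPartition I M x₀ ((extChartAt I x₀).symm z.1)) *
        ENNReal.ofReal ((hamiltonianCoord L x₀ (z.1, z.2))⁻¹ ^ n / n) ≤
      (C ×ˢ (univ : Set (Metric.sphere (0 : Euc n) 1))).indicator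
        (fun _ => ENNReal.ofReal (b ^ n / n)) z := by
    rintro ⟨q, θ⟩ ⟨hq, -⟩
    by_cases hqC : q ∈ C
    · rw [indicator_of_mem (show (q, θ) ∈ C ×ˢ univ from ⟨hqC, mem_univ _⟩)]
      have h1 : chartPartition I M x₀ ((extChartAt I x₀).symm q) ≤ 1 :=
        (chartPartition I M).le_one _ _
      have h2 : (hamiltonianCoord L x₀ (q, θ))⁻¹ ≤ b := by
        have h3 := one_div_lagrangianCoord_le L x₀ hq θ.2
        have h4 := lagrangianCoord_pos L x₀ hq (ne_zero_of_mem_unit_sphere θ)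
        have h5 : lagrangianCoord L x₀ (q, θ) ≤ b := hb ⟨(q, θ), ⟨hqC, θ.2⟩, rfl⟩
        rw [one_div] at h3
        exact (inv_le_of_inv_le₀ h4 h3).trans h5
      have h6 := hamiltonianCoord_pos L x₀ hq (ne_zero_of_mem_unit_sphere θ)
      calc _ ≤ 1 * ENNReal.ofReal (b ^ n / n) := by
            gcongr
            exact ENNReal.ofReal_le_one.2 h1
        _ = _ := one_mul _
    · have h0 : chartPartition I M x₀ ((extChartAt I x₀).symm q) = 0 := by
        by_contra hne
        exact hqC ⟨_, subset_tsupport _ hne, (extChartAt I x₀).right_inv hq⟩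
      simp only [h0, ENNReal.ofReal_zero, zero_mul, zero_le]
  calc _ ≤ ∫⁻ z in (extChartAt I x₀).target ×ˢ (univ : Set (Metric.sphere (0 : Euc n) 1)),
        (C ×ˢ (univ : Set (Metric.sphere (0 : Euc n) 1))).indicator
          (fun _ => ENNReal.ofReal (b ^ n / n)) z
          ∂((volume : Measure (Euc n)).prod (volume : Measure (Euc n)).toSphere) :=
        setLIntegral_mono' ((measurableSet_extChartAt_target x₀).prod .univ) hle
    _ ≤ ∫⁻ z, (C ×ˢ (univ : Set (Metric.sphere (0 : Euc n) 1))).indicator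
          (fun _ => ENNReal.ofReal (b ^ n / n)) z
          ∂((volume : Measure (Euc n)).prod (volume : Measure (Euc n)).toSphere) :=
        setLIntegral_le_lintegral _ _
    _ = ENNReal.ofReal (b ^ n / n) * (volume C * (volume : Measure (Euc n)).toSphere univ) := by
        rw [lintegral_indicator_const (hCc.measurableSet.prod .univ), Measure.prod_prod]
    _ < ⊤ := ENNReal.mul_lt_top ENNReal.ofReal_lt_top
        (ENNReal.mul_lt_top hCc.measure_lt_top (measure_lt_top _ _))

theorem symplecticVolume_codisc_lt_top (L : FinslerMetric I M) :
    symplecticVolume I (codisc (hamiltonian L)) < ⊤ := by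
  rw [symplecticVolume_codisc, cosphereIntegral,
    tsum_eq_sum (s := (finite_support_chartPartition (I := I) (M := M)).toFinset)]
  · exact ENNReal.sum_lt_top.2 fun x₀ _ => setLIntegral_cosphere_lt_top L x₀
  · intro x₀ hx₀
    have h0 : ∀ x, chartPartition I M x₀ x = 0 := by
      intro x
      by_contra hne
      exact hx₀ ((Set.Finite.mem_toFinset _).2 ⟨x, hne⟩)
    simp [h0]

/-- The positivity set of a partition function, seen in the chart, contains a nonempty open subset
of `ℝ^n`, since the range of the model `I` is the closure of its interior. -/
theorem symplecticVolume_codisc_pos [Nonempty M] (L : FinslerMetric I M) :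
    0 < symplecticVolume I (codisc (hamiltonian L)) := by
  obtain ⟨x⟩ := ‹Nonempty M›
  obtain ⟨x₀, hx₀⟩ := (chartPartition I M).exists_pos_of_mem (mem_univ x)
  have hxs : x ∈ (extChartAt I x₀).source := by
    rw [extChartAt_source]
    exact chartPartition_isSubordinate x₀ (subset_tsupport _ hx₀.ne')
  set q := extChartAt I x₀ x with hq
  have hqt : q ∈ (extChartAt I x₀).target := (extChartAt I x₀).map_source hxs
  have hcont : ContinuousAt (fun q => chartPartition I M x₀ ((extChartAt I x₀).symm q)) q :=
    (chartPartition I M x₀).contMDiff.continuous.continuousAt.comp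
      (continuousAt_extChartAt_symm' hxs)
  have hposq : 0 < chartPartition I M x₀ ((extChartAt I x₀).symm q) := by
    rwa [hq, (extChartAt I x₀).left_inv hxs]
  have hnhds : {q' | 0 < chartPartition I M x₀ ((extChartAt I x₀).symm q')} ∩
      (extChartAt I x₀).target ∈ nhdsWithin q (range I) :=
    Filter.inter_mem (mem_nhdsWithin_of_mem_nhds (hcont.eventually_const_lt hposq))
      (extChartAt_target_mem_nhdsWithin' hxs)
  obtain ⟨O, hO, hqO, hOsub⟩ := mem_nhdsWithin.1 hnhds
  have hW : (O ∩ interior (range I)).Nonempty :=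
    mem_closure_iff.1 (I.range_subset_closure_interior (extChartAt_target_subset_range x₀ hqt))
      O hO hqO
  have hWo : IsOpen (O ∩ interior (range I)) := hO.inter isOpen_interior
  have hWsub : O ∩ interior (range I) ⊆
      {q' | 0 < chartPartition I M x₀ ((extChartAt I x₀).symm q')} ∩ (extChartAt I x₀).target :=
    fun y hy => hOsub ⟨hy.1, interior_subset hy.2⟩
  rw [symplecticVolume_codisc, cosphereIntegral]
  refine lt_of_lt_of_le (pos_iff_ne_zero.2 ?_) (ENNReal.le_tsum x₀)
  rw [Ne, lintegral_eq_zero_iff' (aemeasurable_chartPartition_mul L x₀)]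
  intro hae
  rw [Filter.EventuallyEq, ae_restrict_iff'
    ((measurableSet_extChartAt_target x₀).prod .univ)] at hae
  -- the integrand is positive over the open set `O ∩ interior (range I)`
  have hnull : ((volume : Measure (Euc n)).prod (volume : Measure (Euc n)).toSphere)
      ((O ∩ interior (range I)) ×ˢ univ) = 0 := by
    refine measure_mono_null (fun z hz => ?_) (ae_iff.1 hae)
    obtain ⟨h1, h2⟩ := hWsub hz.1
    have h3 := hamiltonianCoord_pos L x₀ h2 (ne_zero_of_mem_unit_sphere z.2)
    simp only [mem_ofPred_eq, Classical.not_imp]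
    refine ⟨⟨h2, mem_univ _⟩, ?_⟩
    have hn : (0 : ℝ) < n := Nat.cast_pos.2 (NeZero.pos n)
    refine mul_ne_zero (ENNReal.ofReal_pos.2 h1).ne' (ENNReal.ofReal_pos.2 ?_).ne'
    positivity
  rw [Measure.prod_prod, mul_eq_zero] at hnull
  rcases hnull with h | h
  · exact (hWo.measure_pos volume hW).ne' h
  · have : Nontrivial (Euc n) := Module.nontrivial_of_finrank_pos (R := ℝ)
      (by rw [finrank_euclideanSpace_fin]; exact NeZero.pos n)
    exact (volume : Measure (Euc n)).toSphere_ne_zero (Measure.measure_univ_eq_zero.1 h)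

end FinitePositive

/-! ### The envelope theorem -/

section Envelope

open Filter Topology

/-- **Envelope theorem**: a maximum `K z = max_w G z w` over a compact space is differentiable at
`z₀` if the maximum point at `z₀` is unique and `G` is continuously differentiable in `z`. -/
theorem hasFDerivWithinAt_of_isGreatest {E W : Type*} [NormedAddCommGroup E] [NormedSpace ℝ E]
    [TopologicalSpace W] [CompactSpace W] {s t : Set E} {z₀ : E} (hz₀ : z₀ ∈ s)
    (hst : s ⊆ t) (ht : Convex ℝ t) (hs : s ∈ 𝓝[t] z₀)
    {G : E → W → ℝ} {G' : E → W → E →L[ℝ] ℝ} {K : E → ℝ} {w₀ : W}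
    (hK : ∀ z ∈ s, IsGreatest (range (G z)) (K z)) (hKc : ContinuousWithinAt K s z₀)
    (hw₀ : G z₀ w₀ = K z₀) (huniq : ∀ w, G z₀ w = K z₀ → w = w₀)
    (hG : ContinuousOn (Function.uncurry G) (s ×ˢ univ))
    (hG' : ∀ z ∈ s, ∀ w, HasFDerivWithinAt (fun z => G z w) (G' z w) s z)
    (hG'c : ContinuousWithinAt (Function.uncurry G') (s ×ˢ univ) (z₀, w₀)) :
    HasFDerivWithinAt K (G' z₀ w₀) s z₀ := by
  rw [hasFDerivWithinAt_iff_isLittleO, Asymptotics.isLittleO_iff]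
  intro ε hε
  -- near `(z₀, w₀)`, the derivative of `G` in `z` is close to `G' z₀ w₀`
  have h1 : ∀ᶠ x in 𝓝[s ×ˢ univ] (z₀, w₀), ‖G' x.1 x.2 - G' z₀ w₀‖ ≤ ε := by
    have h := hG'c.eventually (Metric.closedBall_mem_nhds _ hε)
    filter_upwards [h] with x hx
    rwa [dist_eq_norm] at hx
  rw [nhdsWithin_prod_eq, nhdsWithin_univ] at h1
  obtain ⟨P, hP, N, hN, hPN⟩ := eventually_prod_iff.1 h1
  obtain ⟨r, hr, hball⟩ := Metric.mem_nhdsWithin_iff.1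
    (inter_mem (nhdsWithin_le_of_mem hs hP) hs)
  have hsmall : ∀ z ∈ Metric.ball z₀ r ∩ t, ∀ w, N w →
      ‖G z w - G z₀ w - G' z₀ w₀ (z - z₀)‖ ≤ ε * ‖z - z₀‖ := by
    intro z hz w hw
    refine ((convex_ball z₀ r).inter ht).norm_image_sub_le_of_norm_hasFDerivWithin_le'
      (f := fun z => G z w) (f' := fun z => G' z w) (fun y hy => ?_) (fun y hy => ?_)
      ⟨Metric.mem_ball_self hr, hst hz₀⟩ hz
    · exact (hG' y (hball hy).2 w).mono fun x hx => (hball hx).2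
    · exact hPN (hball hy).1 hw
  -- maximum points for `z` near `z₀` are near `w₀`
  obtain ⟨O, hON, hO, hwO⟩ := mem_nhds_iff.1 hN
  have h2 : ∀ᶠ z in 𝓝 z₀, ∀ w ∈ Oᶜ, z ∈ s → G z w < K z := by
    refine hO.isClosed_compl.isCompact.eventually_forall_of_forall_eventually fun w hw => ?_
    have hlt : G z₀ w < K z₀ := lt_of_le_of_ne ((hK z₀ hz₀).2 ⟨w, rfl⟩) fun h =>
      hw (huniq w h ▸ hwO)
    have hc1 : ContinuousWithinAt (Function.uncurry G) (s ×ˢ univ) (z₀, w) :=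
      hG _ ⟨hz₀, mem_univ _⟩
    have hc2 : ContinuousWithinAt (fun x : E × W => K x.1) (s ×ˢ univ) (z₀, w) :=
      hKc.comp continuousWithinAt_fst fun x hx => hx.1
    have h3 := hc1.eventually_lt hc2 hlt
    rw [eventually_nhdsWithin_iff] at h3
    filter_upwards [h3] with x hx hxs
    exact hx ⟨hxs, mem_univ _⟩
  filter_upwards [nhdsWithin_le_nhds h2, self_mem_nhdsWithin,
    mem_nhdsWithin_of_mem_nhds (Metric.ball_mem_nhds z₀ hr)] with z hz hzs hzr
  obtain ⟨w, hw⟩ := (hK z hzs).1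
  have hwN : N w := hON <| by
    by_contra hcon
    exact (hz w hcon hzs).ne hw
  have h4 := abs_le.1 (hsmall z ⟨hzr, hst hzs⟩ w hwN)
  have h5 := abs_le.1 (hsmall z ⟨hzr, hst hzs⟩ w₀ (hON hwO))
  have h6 : G z₀ w ≤ K z₀ := (hK z₀ hz₀).2 ⟨w, rfl⟩
  have h7 : G z w₀ ≤ K z := (hK z hzs).2 ⟨w₀, rfl⟩
  rw [Real.norm_eq_abs, abs_le]
  constructor <;> linarith

end Envelope

/-! ### Differentiability of the Hamiltonian -/

section Differentiability

open Filter Topology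

variable {n : ℕ} {B : Type*} [TopologicalSpace B] {I : ModelWithCorners ℝ (Euc n) B}
  {M : Type*} [TopologicalSpace M] [ChartedSpace B M] [IsManifold I ∞ M]
  (L : FinslerMetric I M) (x₀ : M)

theorem inner_le_hamiltonianCoord_mul [NeZero n] {q : Euc n}
    (hq : q ∈ (extChartAt I x₀).target)
    (p : Euc n) {y : Euc n} (hy : y ≠ 0) :
    inner ℝ p y ≤ hamiltonianCoord L x₀ (q, p) * lagrangianCoord L x₀ (q, y) := by
  have hy' : 0 < ‖y‖ := norm_pos_iff.2 hy
  have h1 := (isGreatest_hamiltonianCoord L x₀ hq p).2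
    ⟨‖y‖⁻¹ • y, by simp [norm_smul, hy], rfl⟩
  simp only [lagrangianCoord_smul L x₀ q y (inv_pos.2 hy'), real_inner_smul_right] at h1
  rw [mul_div_mul_left _ _ (inv_pos.2 hy').ne'] at h1
  exact (div_le_iff₀ (lagrangianCoord_pos L x₀ hq hy)).1 h1

/-- By quadratic convexity, the restriction of `L` to an affine line has no local maximum at a
nonzero vector. -/
theorem not_isLocalMax_lagrangianCoord {q : Euc n} (hq : q ∈ (extChartAt I x₀).target)
    {v u : Euc n} (hv : v ≠ 0) (hu : u ≠ 0) :
    ¬ IsLocalMax (fun t : ℝ => lagrangianCoord L x₀ (q, v + t • u)) 0 := by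
  intro hmax
  set c := lagrangianCoord L x₀ (q, v) with hc
  have hc0 : 0 < c := lagrangianCoord_pos L x₀ hq hv
  set x := (extChartAt I x₀).symm q with hx
  let S := (trivializationAt (Euc n) (TangentSpace I) x₀).symmL ℝ x
  let h : ℝ → ℝ := fun t => L.toFun ⟨x, S (c⁻¹ • v) + t • S (c⁻¹ • u)⟩
  have hh : ∀ t, h t = c⁻¹ * lagrangianCoord L x₀ (q, v + t • u) := by
    intro t
    rw [← lagrangianCoord_smul L x₀ q _ (inv_pos.2 hc0)]
    have : S (c⁻¹ • v) + t • S (c⁻¹ • u) = S (c⁻¹ • (v + t • u)) := by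
      rw [smul_add, map_add, smul_comm, map_smul S t]
    simp only [h, this]
    rfl
  have hmax' : IsLocalMax h 0 := by
    filter_upwards [hmax] with t ht
    rw [hh, hh]
    exact mul_le_mul_of_nonneg_left ht (inv_pos.2 hc0).le
  have hone : L.toFun ⟨x, S (c⁻¹ • v)⟩ = 1 := by
    have := hh 0
    simp only [h, zero_smul, add_zero] at this
    rw [this]
    exact inv_mul_cancel₀ hc0.ne'
  have hpos := L.quadratically_convex x (S (c⁻¹ • v)) (S (c⁻¹ • u)) hone
    (symmL_ne_zero x₀ hq (smul_ne_zero (inv_pos.2 hc0).ne' hu)) hmax'.deriv_eq_zero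
  have hcont : ContinuousAt h 0 := by
    have h1 : ContinuousAt (fun t : ℝ => lagrangianCoord L x₀ (q, v + t • u)) 0 := by
      have h2 : ContinuousOn (fun w => lagrangianCoord L x₀ (q, w)) {0}ᶜ :=
        (continuousOn_lagrangianCoord L x₀).comp (f := fun w => (q, w)) (by fun_prop)
          fun w hw => ⟨hq, hw⟩
      refine ContinuousAt.comp (f := fun t : ℝ => v + t • u)
        (g := fun w => lagrangianCoord L x₀ (q, w)) ?_ (by fun_prop)
      simp only [zero_smul, add_zero]
      exact h2.continuousAt (isOpen_compl_singleton.mem_nhds hv)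
    rw [show h = fun t => c⁻¹ * lagrangianCoord L x₀ (q, v + t • u) from funext hh]
    exact h1.const_mul _
  -- a critical point with positive second derivative is a local minimum as well
  have hmin : IsLocalMin h 0 := by
    refine isLocalMin_of_deriv_deriv_pos ?_ hmax'.deriv_eq_zero hcont
    rw [iteratedDeriv_succ, iteratedDeriv_one] at hpos
    exact hpos
  have hconst : h =ᶠ[𝓝 0] fun _ => h 0 := by
    filter_upwards [hmax', hmin] with t h1 h2
    exact le_antisymm h1 h2
  have h0 := hconst.iteratedDeriv_eq 2
  change 0 < iteratedDeriv 2 h 0 at hpos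
  rw [h0, iteratedDeriv_const] at hpos
  simp at hpos

/-- The maximum which defines the Hamiltonian is attained at one point only. Otherwise the segment
between two maximum points of the covector on `{L = 1}` would lie in `{L ≥ 1}`, and `L` would have
a local maximum along it. -/
theorem eq_of_inner_div_eq_hamiltonianCoord [NeZero n] {q : Euc n}
    (hq : q ∈ (extChartAt I x₀).target)
    {p : Euc n} (hp : p ≠ 0) {w₁ w₂ : Euc n} (hw₁ : w₁ ∈ Metric.sphere (0 : Euc n) 1)
    (hw₂ : w₂ ∈ Metric.sphere (0 : Euc n) 1)
    (h₁ : inner ℝ p w₁ / lagrangianCoord L x₀ (q, w₁) = hamiltonianCoord L x₀ (q, p))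
    (h₂ : inner ℝ p w₂ / lagrangianCoord L x₀ (q, w₂) = hamiltonianCoord L x₀ (q, p)) :
    w₁ = w₂ := by
  set m := hamiltonianCoord L x₀ (q, p) with hm
  have hm0 : 0 < m := hamiltonianCoord_pos L x₀ hq hp
  have hl₁ := lagrangianCoord_pos L x₀ hq (ne_zero_of_mem_unit_sphere ⟨w₁, hw₁⟩)
  have hl₂ := lagrangianCoord_pos L x₀ hq (ne_zero_of_mem_unit_sphere ⟨w₂, hw₂⟩)
  set l₁ := lagrangianCoord L x₀ (q, w₁)
  set l₂ := lagrangianCoord L x₀ (q, w₂)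
  by_contra hne
  set v := l₁⁻¹ • w₁ with hv
  set u := l₂⁻¹ • w₂ - v with hu
  have hu0 : u ≠ 0 := by
    intro h0
    have h3 : l₂⁻¹ • w₂ = l₁⁻¹ • w₁ := sub_eq_zero.1 h0
    have h4 := congrArg norm h3
    have e1 : ‖w₁‖ = 1 := by simpa using hw₁
    have e2 : ‖w₂‖ = 1 := by simpa using hw₂
    rw [norm_smul, norm_smul, e1, e2, mul_one, mul_one, Real.norm_of_nonneg (inv_pos.2 hl₁).le,
      Real.norm_of_nonneg (inv_pos.2 hl₂).le] at h4
    rw [h4] at h3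
    exact hne (smul_right_injective _ (inv_pos.2 hl₁).ne' h3).symm
  have hpv : inner ℝ p v = m := by
    rw [hv, real_inner_smul_right, ← h₁]; ring
  have hpu : inner ℝ p u = 0 := by
    rw [hu, inner_sub_right, hpv, real_inner_smul_right, ← h₂]; ring
  have hline : ∀ t : ℝ, inner ℝ p (v + t • u) = m := fun t => by
    rw [inner_add_right, real_inner_smul_right p u, hpu, hpv]; ring
  have hline0 : ∀ t : ℝ, v + t • u ≠ 0 := fun t h0 => by
    have := hline t
    rw [h0, inner_zero_right] at this
    exact hm0.ne this
  let g : ℝ → ℝ := fun t => lagrangianCoord L x₀ (q, v + t • u)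
  have hg1 : ∀ t, 1 ≤ g t := fun t => by
    have := inner_le_hamiltonianCoord_mul L x₀ hq p (hline0 t)
    rw [hline] at this
    exact le_of_mul_le_mul_left (by rw [mul_one]; exact this) hm0
  have hg_zero : g 0 = 1 := by
    simp only [g, zero_smul, add_zero, hv]
    rw [lagrangianCoord_smul L x₀ q w₁ (inv_pos.2 hl₁)]
    exact inv_mul_cancel₀ hl₁.ne'
  have hg_one : g 1 = 1 := by
    simp only [g, one_smul, hu, add_sub_cancel]
    rw [lagrangianCoord_smul L x₀ q w₂ (inv_pos.2 hl₂)]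
    exact inv_mul_cancel₀ hl₂.ne'
  have hgc : Continuous g :=
    (continuousOn_lagrangianCoord L x₀).comp_continuous (f := fun t : ℝ => (q, v + t • u))
      (by fun_prop) fun t => ⟨hq, hline0 t⟩
  -- a maximum point on the segment can be taken in its interior: a maximum at an end
  -- point has the value `1`, which is also the minimum, so that `g = 1` on the segment
  obtain ⟨c, hc, hcmax⟩ : ∃ c ∈ Ioo (0 : ℝ) 1, IsMaxOn g (Icc 0 1) c := by
    obtain ⟨c, hc, hcmax⟩ := isCompact_Icc.exists_isMaxOn (nonempty_Icc.2 zero_le_one)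
      hgc.continuousOn
    by_cases hc' : c ∈ Ioo (0 : ℝ) 1
    · exact ⟨c, hc', hcmax⟩
    · have hgc1 : g c = 1 := by
        rcases eq_or_lt_of_le hc.1 with h | h
        · rw [← h, hg_zero]
        · rcases eq_or_lt_of_le hc.2 with h' | h'
          · rw [h', hg_one]
          · exact absurd ⟨h, h'⟩ hc'
      refine ⟨1 / 2, by norm_num, fun t ht => ?_⟩
      have h3 : g t ≤ g c := hcmax ht
      exact h3.trans (hgc1.le.trans (hg1 _))
  refine not_isLocalMax_lagrangianCoord L x₀ hq (hline0 c) hu0 ?_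
  have hev : ∀ᶠ t : ℝ in 𝓝 0, c + t ∈ Icc (0 : ℝ) 1 := by
    have h3 : Continuous (fun t : ℝ => c + t) := by fun_prop
    have h4 : Tendsto (fun t : ℝ => c + t) (𝓝 0) (𝓝 c) := by simpa using h3.tendsto 0
    exact h4.eventually (Icc_mem_nhds hc.1 hc.2)
  filter_upwards [hev] with t ht
  have h3 : g (c + t) ≤ g c := hcmax ht
  simp only [g] at h3
  simpa [add_smul, add_assoc] using h3

theorem differentiableWithinAt_hamiltonianCoord [NeZero n] {q : Euc n}
    (hq : q ∈ (extChartAt I x₀).target)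
    {p : Euc n} (hp : p ≠ 0) :
    DifferentiableWithinAt ℝ (hamiltonianCoord L x₀) ((extChartAt I x₀).target ×ˢ univ) (q, p) := by
  let F : PhaseSpace n × Euc n → ℝ := fun y => inner ℝ y.1.2 y.2 / lagrangianCoord L x₀ (y.1.1, y.2)
  let D : Set (PhaseSpace n × Euc n) := ((extChartAt I x₀).target ×ˢ univ) ×ˢ {0}ᶜ
  have hS : ∀ w : Metric.sphere (0 : Euc n) 1, (w : Euc n) ≠ 0 := ne_zero_of_mem_unit_sphere
  have hD : UniqueDiffOn ℝ D := ((uniqueDiffOn_extChartAt_target x₀).prod uniqueDiffOn_univ).prod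
    isOpen_compl_singleton.uniqueDiffOn
  have hF : ContDiffOn ℝ ∞ F D := by
    refine ContDiffOn.div (ContDiffOn.inner ℝ (by fun_prop) (by fun_prop)) ?_
      fun y hy => (lagrangianCoord_pos L x₀ hy.1.1 hy.2).ne'
    exact (contDiffOn_lagrangianCoord L x₀).comp
      (f := fun y : PhaseSpace n × Euc n => (y.1.1, y.2)) (by fun_prop) fun y hy => ⟨hy.1.1, hy.2⟩
  have hFd := hF.differentiableOn (by simp)
  have hF'c : ContinuousOn (fderivWithin ℝ F D) D := hF.continuousOn_fderivWithin hD (by simp)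
  obtain ⟨⟨w₀, hw₀, hmax⟩, -⟩ := isGreatest_hamiltonianCoord L x₀ hq p
  refine (hasFDerivWithinAt_of_isGreatest
    (s := (extChartAt I x₀).target ×ˢ univ) (z₀ := (q, p)) (t := range I ×ˢ univ) (w₀ := ⟨w₀, hw₀⟩)
    (G := fun z (w : Metric.sphere (0 : Euc n) 1) => F (z, w))
    (G' := fun z w => (fderivWithin ℝ F D (z, w)).comp (ContinuousLinearMap.inl ℝ _ _))
    ⟨hq, mem_univ _⟩ (prod_mono (extChartAt_target_subset_range x₀) le_rfl)
    (I.convex_range.prod convex_univ) ?_ ?_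
    (continuousOn_hamiltonianCoord L x₀ _ ⟨hq, mem_univ _⟩) hmax ?_ ?_ ?_
    ?_).differentiableWithinAt
  · rw [nhdsWithin_prod_eq]
    refine prod_mem_prod ?_ univ_mem
    have := extChartAt_target_mem_nhdsWithin' (I := I) ((extChartAt I x₀).map_target hq)
    rwa [(extChartAt I x₀).right_inv hq] at this
  · rintro ⟨q', p'⟩ hz
    have := isGreatest_hamiltonianCoord L x₀ hz.1 p'
    convert this using 1
    ext y
    simp [F]
  · intro w hw
    exact Subtype.ext (eq_of_inner_div_eq_hamiltonianCoord L x₀ hq hp w.2 hw₀ hw hmax)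
  · exact hF.continuousOn.comp
      (f := fun y : PhaseSpace n × Metric.sphere (0 : Euc n) 1 => (y.1, (y.2 : Euc n)))
      (by fun_prop) fun y hy => ⟨hy.1, hS y.2⟩
  · intro z hz w
    have h1 : HasFDerivWithinAt (fun z : PhaseSpace n => (z, (w : Euc n)))
        (ContinuousLinearMap.inl ℝ (PhaseSpace n) (Euc n)) ((extChartAt I x₀).target ×ˢ univ) z :=
      (hasFDerivAt_prodMk_left z (w : Euc n)).hasFDerivWithinAt
    have h2 : HasFDerivWithinAt F (fderivWithin ℝ F D (z, (w : Euc n))) D (z, (w : Euc n)) :=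
      (hFd (z, w) ⟨hz, hS w⟩).hasFDerivWithinAt
    have h3 : MapsTo (fun z : PhaseSpace n => (z, (w : Euc n))) ((extChartAt I x₀).target ×ˢ univ)
        D := fun y hy => ⟨hy, hS w⟩
    exact h2.comp z h1 h3
  · have h1 : ContinuousOn (fun y : PhaseSpace n × Metric.sphere (0 : Euc n) 1 =>
        fderivWithin ℝ F D (y.1, (y.2 : Euc n))) (((extChartAt I x₀).target ×ˢ univ) ×ˢ univ) :=
      hF'c.comp
        (f := fun y : PhaseSpace n × Metric.sphere (0 : Euc n) 1 => (y.1, (y.2 : Euc n)))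
        (by fun_prop) fun y hy => ⟨hy.1, hS y.2⟩
    exact (h1.clm_comp continuousOn_const) _ ⟨⟨hq, mem_univ _⟩, mem_univ _⟩

end Differentiability

/-! ### Dual mixed volumes and the dual Minkowski inequality -/

section DualMixedVolumes

variable {n : ℕ} [NeZero n] {B : Type*} [TopologicalSpace B] {I : ModelWithCorners ℝ (Euc n) B}
  {M : Type*} [TopologicalSpace M] [ChartedSpace B M] [IsManifold I ∞ M]

/-- The derivative of the radial parametrization `(q, p) ↦ (q, ρ(q, p) p)`, up to the summand along
`p` which contains the derivative of `ρ = 1 / H`. -/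
theorem exists_fderivWithin_radialParam (L : FinslerMetric I M) (x₀ : M) {q : Euc n}
    (hq : q ∈ (extChartAt I x₀).target) {p : Euc n} (hp : p ≠ 0) :
    ∃ a : PhaseSpace n → ℝ, ∀ X, fderivWithin ℝ (radialParam I (hamiltonian L) x₀)
      ((extChartAt I x₀).target ×ˢ univ) (q, p) X =
        (X.1, (hamiltonianCoord L x₀ (q, p))⁻¹ • X.2 + a X • p) := by
  have hρ : DifferentiableWithinAt ℝ (fun z => (hamiltonianCoord L x₀ z)⁻¹)
      ((extChartAt I x₀).target ×ˢ univ) (q, p) :=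
    (differentiableWithinAt_hamiltonianCoord L x₀ hq hp).fun_inv
      (hamiltonianCoord_pos L x₀ hq hp).ne'
  have h := (hasFDerivWithinAt_fst (𝕜 := ℝ) (E := Euc n) (F := Euc n)
    (s := (extChartAt I x₀).target ×ˢ univ) (p := (q, p))).prodMk
    (hρ.hasFDerivWithinAt.smul hasFDerivWithinAt_snd)
  have h' := HasFDerivWithinAt.fderivWithin h
    (((uniqueDiffOn_extChartAt_target x₀).prod uniqueDiffOn_univ) _ ⟨hq, mem_univ _⟩)
  refine ⟨fun X => fderivWithin ℝ (fun z => (hamiltonianCoord L x₀ z)⁻¹)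
      ((extChartAt I x₀).target ×ˢ univ) (q, p) X, fun X => ?_⟩
  have h2 : radialParam I (hamiltonian L) x₀ =
      fun z => (z.1, ((fun z => (hamiltonianCoord L x₀ z)⁻¹) • Prod.snd) z) := rfl
  rw [h2, h']
  simp

theorem prod_ite_val_lt {m : ℕ} (hm : m ≤ n) (x y : ℝ) :
    ∏ i : Fin n, (if i.1 < m then x else y) = x ^ m * y ^ (n - m) := by
  obtain ⟨l, rfl⟩ := Nat.exists_eq_add_of_le hm
  rw [Fin.prod_univ_add]
  simp

variable [T2Space M] [CompactSpace M]

/-- The dual mixed volumes of two codisc bundles, as integrals over the Euclidean unit cospheres. -/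
theorem dualMixedVolumeK_hamiltonian (L L₀ : FinslerMetric I M) {k : ℕ} (hk : k ≤ n) :
    dualMixedVolumeK I k (hamiltonian L₀) (hamiltonian L) (hamiltonian L₀) =
      cosphereIntegral I fun x₀ z =>
        (hamiltonianCoord L x₀ z)⁻¹ ^ (n - k) * (hamiltonianCoord L₀ x₀ z)⁻¹ ^ k / n := by
  refine tsum_congr fun x₀ => setLIntegral_congr_fun
    ((measurableSet_extChartAt_target x₀).prod .univ) ?_
  rintro ⟨q, θ⟩ ⟨hq, -⟩
  have hθ := ne_zero_of_mem_unit_sphere θ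
  set a := hamiltonianCoord L x₀ (q, θ) with ha
  set b := hamiltonianCoord L₀ x₀ (q, θ) with hb
  have ha0 : 0 < a := hamiltonianCoord_pos L x₀ hq hθ
  have hb0 : 0 < b := hamiltonianCoord_pos L₀ x₀ hq hθ
  have hΩ : |omegaForm (radialParam I (hamiltonian L₀) x₀ (q, θ)) fun j =>
      fderivWithin ℝ (radialParam I (hamiltonian L₀) x₀) ((extChartAt I x₀).target ×ˢ univ)
        (q, θ) (productFrame θ j)| = b⁻¹ ^ n / n := by
    obtain ⟨c, hc⟩ := exists_fderivWithin_radialParam L₀ x₀ hq hθ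
    simp only [hc]
    exact abs_omegaForm_radial q θ _ (inv_pos.2 hb0).le _
  have hprod : ∏ i : Fin n, 1 / (if i.1 < n - k then hamiltonian L else hamiltonian L₀)
      (cotangentCoord I x₀ (radialParam I (hamiltonian L₀) x₀ (q, θ))) = (b * a⁻¹) ^ (n - k) := by
    have h1 : hamiltonian L (cotangentCoord I x₀ (radialParam I (hamiltonian L₀) x₀ (q, θ))) =
        b⁻¹ * a := hamiltonianCoord_smul L x₀ hq θ (inv_pos.2 hb0).le
    have h2 : hamiltonian L₀ (cotangentCoord I x₀ (radialParam I (hamiltonian L₀) x₀ (q, θ))) =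
        b⁻¹ * b := hamiltonianCoord_smul L₀ x₀ hq θ (inv_pos.2 hb0).le
    have h3 : ∀ i : Fin n, 1 / (if i.1 < n - k then hamiltonian L else hamiltonian L₀)
        (cotangentCoord I x₀ (radialParam I (hamiltonian L₀) x₀ (q, θ))) =
        if i.1 < n - k then b * a⁻¹ else 1 := fun i => by
      split_ifs
      · rw [h1]; field_simp
      · rw [h2]; field_simp
    rw [Finset.prod_congr rfl fun i _ => h3 i, prod_ite_val_lt (Nat.sub_le n k)]
    simp
  simp only
  rw [hΩ, hprod, mul_assoc, ← ENNReal.ofReal_mul (by positivity)]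
  congr 2
  have : b⁻¹ ^ n = b⁻¹ ^ (n - k) * b⁻¹ ^ k := by rw [← pow_add, Nat.sub_add_cancel hk]
  rw [this, mul_pow]
  have : b ^ (n - k) * b⁻¹ ^ (n - k) = 1 := by
    rw [← mul_pow, mul_inv_cancel₀ hb0.ne', one_pow]
  linear_combination (a⁻¹ ^ (n - k) * b⁻¹ ^ k / n) * this

theorem cosphereIntegral_linear (L L₀ : FinslerMetric I M) {c c₀ : ℝ} (hc : 0 ≤ c) (hc₀ : 0 ≤ c₀) :
    cosphereIntegral I (fun x₀ z => c * ((hamiltonianCoord L x₀ z)⁻¹ ^ n / n) +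
        c₀ * ((hamiltonianCoord L₀ x₀ z)⁻¹ ^ n / n)) =
      ENNReal.ofReal c * symplecticVolume I (codisc (hamiltonian L)) +
        ENNReal.ofReal c₀ * symplecticVolume I (codisc (hamiltonian L₀)) := by
  rw [symplecticVolume_codisc, symplecticVolume_codisc, cosphereIntegral, cosphereIntegral,
    cosphereIntegral, ← ENNReal.tsum_mul_left, ← ENNReal.tsum_mul_left, ← ENNReal.tsum_add]
  refine tsum_congr fun x₀ => ?_
  rw [← lintegral_const_mul' _ _ ENNReal.ofReal_ne_top,
    ← lintegral_const_mul' _ _ ENNReal.ofReal_ne_top,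
    ← lintegral_add_left' ((aemeasurable_chartPartition_mul L x₀).const_mul _)]
  refine setLIntegral_congr_fun ((measurableSet_extChartAt_target x₀).prod .univ) ?_
  rintro ⟨q, θ⟩ ⟨hq, -⟩
  have h1 := hamiltonianCoord_pos L x₀ hq (ne_zero_of_mem_unit_sphere θ)
  have h2 := hamiltonianCoord_pos L₀ x₀ hq (ne_zero_of_mem_unit_sphere θ)
  simp only
  rw [ENNReal.ofReal_add (by positivity) (by positivity), ENNReal.ofReal_mul hc,
    ENNReal.ofReal_mul hc₀]
  ring

/-- Weighted arithmetic-geometric mean inequality, normalized by positive numbers `v` and `v₀`. -/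
theorem pow_mul_pow_le_normalized {k : ℕ} (hk : k ≤ n) {a b v v₀ : ℝ} (ha : 0 ≤ a) (hb : 0 ≤ b)
    (hv : 0 < v) (hv₀ : 0 < v₀) :
    a ^ (n - k) * b ^ k ≤ v ^ ((n - k : ℝ) / n) * v₀ ^ ((k : ℝ) / n) *
      ((n - k : ℝ) / n * (a ^ n / v) + k / n * (b ^ n / v₀)) := by
  have hn : (0 : ℝ) < n := Nat.cast_pos.2 (NeZero.pos n)
  have hkn : (k : ℝ) ≤ n := Nat.cast_le.2 hk
  have h := Real.geom_mean_le_arith_mean2_weighted (w₁ := (n - k : ℝ) / n) (w₂ := k / n)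
    (p₁ := a ^ n / v) (p₂ := b ^ n / v₀) (div_nonneg (sub_nonneg.2 hkn) hn.le) (by positivity)
    (by positivity) (by positivity) (by field_simp; ring)
  have hroot : ∀ {x : ℝ}, 0 ≤ x → ∀ j : ℕ, (x ^ n) ^ ((j : ℝ) / n) = x ^ j := fun {x} hx j => by
    rw [← Real.rpow_natCast x n, ← Real.rpow_mul hx, mul_div_cancel₀ _ hn.ne', Real.rpow_natCast]
  have hcast : ((n : ℝ) - k) / n = ((n - k : ℕ) : ℝ) / n := by rw [Nat.cast_sub hk]
  rw [Real.div_rpow (by positivity) hv.le, Real.div_rpow (by positivity) hv₀.le, hroot hb] at h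
  have h1 : (a ^ n) ^ (((n : ℝ) - k) / n) = a ^ (n - k) := by rw [hcast, hroot ha]
  rw [h1] at h
  have hp : 0 < v ^ ((n - k : ℝ) / n) := by positivity
  have hp₀ : 0 < v₀ ^ ((k : ℝ) / n) := by positivity
  calc a ^ (n - k) * b ^ k = v ^ ((n - k : ℝ) / n) * v₀ ^ ((k : ℝ) / n) *
        (a ^ (n - k) / v ^ ((n - k : ℝ) / n) * (b ^ k / v₀ ^ ((k : ℝ) / n))) := by
        field_simp
    _ ≤ _ := mul_le_mul_of_nonneg_left h (mul_pos hp hp₀).le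

/-- The dual Minkowski inequality for codisc bundles. -/
theorem dualMixedVolumeK_pow_le [Nonempty M] (L L₀ : FinslerMetric I M) {k : ℕ} (hk : k ≤ n) :
    dualMixedVolumeK I k (hamiltonian L₀) (hamiltonian L) (hamiltonian L₀) ^ n ≤
      symplecticVolume I (codisc (hamiltonian L)) ^ (n - k) *
        symplecticVolume I (codisc (hamiltonian L₀)) ^ k := by
  have hn : (0 : ℝ) < n := Nat.cast_pos.2 (NeZero.pos n)
  have hkn : (k : ℝ) ≤ n := Nat.cast_le.2 hk
  -- both volumes are positive real numbers, so that the densities can be normalized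
  obtain ⟨v, hv, hV⟩ : ∃ v : ℝ, 0 < v ∧
      symplecticVolume I (codisc (hamiltonian L)) = ENNReal.ofReal v :=
    ⟨_, ENNReal.toReal_pos (symplecticVolume_codisc_pos L).ne'
      (symplecticVolume_codisc_lt_top L).ne,
      (ENNReal.ofReal_toReal (symplecticVolume_codisc_lt_top L).ne).symm⟩
  obtain ⟨v₀, hv₀, hV₀⟩ : ∃ v : ℝ, 0 < v ∧
      symplecticVolume I (codisc (hamiltonian L₀)) = ENNReal.ofReal v :=
    ⟨_, ENNReal.toReal_pos (symplecticVolume_codisc_pos L₀).ne'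
      (symplecticVolume_codisc_lt_top L₀).ne,
      (ENNReal.ofReal_toReal (symplecticVolume_codisc_lt_top L₀).ne).symm⟩
  -- the `n`-th root of the right-hand side
  set C : ℝ := v ^ ((n - k : ℝ) / n) * v₀ ^ ((k : ℝ) / n) with hC
  have hC0 : 0 < C := by positivity
  have hc : 0 ≤ C * ((n - k : ℝ) / n) / v :=
    div_nonneg (mul_nonneg hC0.le (div_nonneg (sub_nonneg.2 hkn) hn.le)) hv.le
  have hc₀ : 0 ≤ C * (k / n) / v₀ := by positivity
  have hle : dualMixedVolumeK I k (hamiltonian L₀) (hamiltonian L) (hamiltonian L₀) ≤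
      ENNReal.ofReal C := by
    calc _ = cosphereIntegral I (fun x₀ z =>
          (hamiltonianCoord L x₀ z)⁻¹ ^ (n - k) * (hamiltonianCoord L₀ x₀ z)⁻¹ ^ k / n) :=
          dualMixedVolumeK_hamiltonian L L₀ hk
      _ ≤ cosphereIntegral I (fun x₀ z =>
          C * ((n - k : ℝ) / n) / v * ((hamiltonianCoord L x₀ z)⁻¹ ^ n / n) +
          C * (k / n) / v₀ * ((hamiltonianCoord L₀ x₀ z)⁻¹ ^ n / n)) := by
          refine cosphereIntegral_mono fun x₀ q hq θ => ?_
          have h1 := hamiltonianCoord_pos L x₀ hq (ne_zero_of_mem_unit_sphere θ)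
          have h2 := hamiltonianCoord_pos L₀ x₀ hq (ne_zero_of_mem_unit_sphere θ)
          have h3 := pow_mul_pow_le_normalized hk (inv_pos.2 h1).le (inv_pos.2 h2).le hv hv₀
          rw [← hC] at h3
          refine (div_le_div_of_nonneg_right h3 hn.le).trans_eq ?_
          ring
      _ = ENNReal.ofReal (C * ((n - k : ℝ) / n) / v * v + C * (k / n) / v₀ * v₀) := by
          rw [cosphereIntegral_linear L L₀ hc hc₀, hV, hV₀, ← ENNReal.ofReal_mul hc,
            ← ENNReal.ofReal_mul hc₀, ← ENNReal.ofReal_add (mul_nonneg hc hv.le)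
            (mul_nonneg hc₀ hv₀.le)]
      _ = ENNReal.ofReal C := by
          congr 1
          field_simp
          ring
  have hCn : C ^ n = v ^ (n - k) * v₀ ^ k := by
    rw [hC, mul_pow, ← Real.rpow_natCast, ← Real.rpow_natCast (v₀ ^ _), ← Real.rpow_mul hv.le,
      ← Real.rpow_mul hv₀.le, div_mul_cancel₀ _ hn.ne', div_mul_cancel₀ _ hn.ne',
      ← Nat.cast_sub hk, Real.rpow_natCast, Real.rpow_natCast]
  calc _ ≤ ENNReal.ofReal C ^ n := pow_le_pow_left' hle n
    _ = _ := by
      rw [← ENNReal.ofReal_pow hC0.le, hCn, hV, hV₀, ENNReal.ofReal_mul (by positivity),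
        ENNReal.ofReal_pow hv.le, ENNReal.ofReal_pow hv₀.le]

theorem holmesThompsonVolume_pos [Nonempty M] (L : FinslerMetric I M) :
    0 < holmesThompsonVolume L :=
  ENNReal.div_pos (symplecticVolume_codisc_pos L).ne' (isCompact_closedBall _ _).measure_lt_top.ne

theorem holmesThompsonVolume_lt_top (L : FinslerMetric I M) : holmesThompsonVolume L < ⊤ :=
  ENNReal.div_lt_top (symplecticVolume_codisc_lt_top L).ne
    (Metric.measure_closedBall_pos volume _ one_pos).ne'

end DualMixedVolumes

end Finsler

theorem mainTheorem10 {n : ℕ} [NeZero n] {B : Type*} [TopologicalSpace B]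
    (I : ModelWithCorners ℝ (EuclideanSpace ℝ (Fin n)) B)
    (M : Type*) [TopologicalSpace M] [ChartedSpace B M] [IsManifold I ∞ M]
    [T2Space M] [CompactSpace M] [Nonempty M]
    (L L₀ : Finsler.FinslerMetric I M) (k : ℕ) (hk : k ≤ n) :
    (0 < Finsler.holmesThompsonVolume L ∧ Finsler.holmesThompsonVolume L < ⊤) ∧
    (0 < Finsler.holmesThompsonVolume L₀ ∧ Finsler.holmesThompsonVolume L₀ < ⊤) ∧
    Finsler.normalizedDualMixedVolume k L L₀ ^ n ≤
      Finsler.holmesThompsonVolume L ^ (n - k) / Finsler.holmesThompsonVolume L₀ ^ (n - k) := by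
  refine ⟨⟨Finsler.holmesThompsonVolume_pos L, Finsler.holmesThompsonVolume_lt_top L⟩,
    ⟨Finsler.holmesThompsonVolume_pos L₀, Finsler.holmesThompsonVolume_lt_top L₀⟩, ?_⟩
  have hmain := Finsler.dualMixedVolumeK_pow_le L L₀ hk
  have hpos₀ := (Finsler.symplecticVolume_codisc_pos L₀).ne'
  have htop₀ := (Finsler.symplecticVolume_codisc_lt_top L₀).ne
  have hw : volume (Metric.closedBall (0 : Finsler.Euc n) 1) ≠ 0 :=
    (Metric.measure_closedBall_pos volume _ one_pos).ne'
  have hw' : volume (Metric.closedBall (0 : Finsler.Euc n) 1) ≠ ⊤ :=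
    (isCompact_closedBall _ _).measure_lt_top.ne
  rw [Finsler.normalizedDualMixedVolume, Finsler.holmesThompsonVolume,
    Finsler.holmesThompsonVolume]
  set V := Finsler.symplecticVolume I (Finsler.codisc (Finsler.hamiltonian L))
  set V₀ := Finsler.symplecticVolume I (Finsler.codisc (Finsler.hamiltonian L₀))
  set w := volume (Metric.closedBall (0 : Finsler.Euc n) 1)
  have hinv : V₀ ^ k * V₀⁻¹ ^ k = 1 := by
    rw [← mul_pow, ENNReal.mul_inv_cancel hpos₀ htop₀, one_pow]
  calc _ ≤ V ^ (n - k) * V₀ ^ k * V₀⁻¹ ^ n := by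
        rw [div_eq_mul_inv, mul_pow]
        gcongr
    _ = V ^ (n - k) * V₀⁻¹ ^ (n - k) * (V₀ ^ k * V₀⁻¹ ^ k) := by
        rw [show V₀⁻¹ ^ n = V₀⁻¹ ^ (n - k) * V₀⁻¹ ^ k by rw [← pow_add, Nat.sub_add_cancel hk]]
        ring
    _ = V ^ (n - k) / V₀ ^ (n - k) := by
        rw [hinv, mul_one, div_eq_mul_inv, ENNReal.inv_pow]
    _ = _ := by
        rw [div_eq_mul_inv V, div_eq_mul_inv V₀, mul_pow, mul_pow, ENNReal.mul_div_mul_right]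
        · exact pow_ne_zero _ (ENNReal.inv_ne_zero.2 hw')
        · exact ENNReal.pow_ne_top (ENNReal.inv_ne_top.2 hw)
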